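/- Let $\mathcal{S}_{\mathrm{per}}$ be the space of all $f\in C^\infty(\mathbb{R}^2;\mathbb{C})$, $f=f(t,x)$, with $f(t,x+2\pi)=f(t,x)$ and $\sup_{t,x}|t|^k|\partial_t^m\partial_x^n f(t,x)|<\infty$ for all $k,m,n\ge 0$. For $\tau\in\mathbb{R}$, $\xi\in\mathbb{Z}$ put $\mathcal{F}f(\tau,\xi)=\frac{1}{2\pi}\int_{\mathbb{R}}\int_0^{2\pi}e^{-it\tau-ix\xi}f(t,x)\,dx\,dt$, write $\langle a\rangle=(1+|a|^2)^{1/2}$, and for $s,b\in\mathbb{R}$ define $$\|f\|_{X_{s,b}}^2=\sum_{\xi\in\mathbb{Z}}\int_{\mathbb{R}}\langle\xi\rangle^{2s}\langle\tau+\xi^2\rangle^{2b}|\mathcal{F}f(\tau,\xi)|^2\,d\tau,\qquad \|f\|_{X^-_{s,b}}^2=\sum_{\xi\in\mathbb{Z}}\int_{\mathbb{R}}\langle\xi\rangle^{2s}\langle\tau-\xi^2\rangle^{2b}|\mathcal{F}f(\tau,\xi)|^2\,d\tau .$$ There exist $c,\varepsilon>0$ such that for every $T\in(0,1]$ and all $u_1,u_2,u_3\in\mathcal{S}_{\mathrm{per}}$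 with $\operatorname{supp}(u_j)\subset\{(t,x): |t|\le T\}$ for $j=1,2,3$, $$\|u_1u_2\,\partial_xu_3\|_{X_{\frac12,-\frac12}}\le c\,T^{\varepsilon}\,\|u_1\|_{X_{\frac12,\frac12}}\|u_2\|_{X_{\frac12,\frac12}}\|u_3\|_{X^-_{\frac12,\frac12}} .$$ -/

import Mathlib

open scoped ENNReal ContDiff

noncomputable section

namespace PeriodicBourgain

/-- The space `S_per`: smooth complex-valued functions of `(t, x) ∈ ℝ²`, `2π`-periodic in `x`,
which together with all their derivatives decay rapidly in `t`, uniformly in `x`. -/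
structure IsSPer (f : ℝ → ℝ → ℂ) : Prop where
  periodic : ∀ t x : ℝ, f t (x + 2 * Real.pi) = f t x
  smooth : ContDiff ℝ ∞ (fun p : ℝ × ℝ => f p.1 p.2)
  decay : ∀ k n : ℕ, ∃ C : ℝ, ∀ t x : ℝ,
    |t| ^ k * ‖iteratedFDeriv ℝ n (fun p : ℝ × ℝ => f p.1 p.2) (t, x)‖ ≤ C

/-- Fourier coefficient of a `2π`-periodic function,
`(2π)^{-1/2} ∫_0^{2π} e^{-i x ξ} g(x) dx` for `ξ ∈ ℤ`. -/
def fourierX (g : ℝ → ℂ) (ξ : ℤ) : ℂ :=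
  (((2 * Real.pi) ^ (-(1 / 2) : ℝ) : ℝ) : ℂ) *
    ∫ x in (0 : ℝ)..(2 * Real.pi), Complex.exp (-(Complex.I * (x : ℂ) * (ξ : ℂ))) * g x

/-- Fourier transform in time, `(2π)^{-1/2} ∫_ℝ e^{-i t τ} g(t) dt`. -/
def fourierT (g : ℝ → ℂ) (τ : ℝ) : ℂ :=
  (((2 * Real.pi) ^ (-(1 / 2) : ℝ) : ℝ) : ℂ) *
    ∫ t : ℝ, Complex.exp (-(Complex.I * (t : ℂ) * (τ : ℂ))) * g t

/-- Space-time Fourier transform at `(τ, ξ) ∈ ℝ × ℤ`. -/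
def fourierTX (f : ℝ → ℝ → ℂ) (τ : ℝ) (ξ : ℤ) : ℂ :=
  fourierT (fun t => fourierX (f t) ξ) τ

/-- The bracket `⟨a⟩ = (1 + |a|²)^{1/2}`. -/
def bracket (a : ℝ) : ℝ := Real.sqrt (1 + |a| ^ 2)

/-- The norm of `X_{s,b}`, with weight `⟨τ + ξ²⟩`, as an extended nonnegative real. -/
def normX (s b : ℝ) (f : ℝ → ℝ → ℂ) : ℝ≥0∞ :=
  (∑' ξ : ℤ, ∫⁻ τ : ℝ, ENNReal.ofReal
    (bracket (ξ : ℝ) ^ (2 * s) * bracket (τ + (ξ : ℝ) ^ 2) ^ (2 * b) *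
      ‖fourierTX f τ ξ‖ ^ 2)) ^ (1 / 2 : ℝ)

/-- The norm of `X⁻_{s,b}`, with weight `⟨τ - ξ²⟩`, as an extended nonnegative real. -/
def normXMinus (s b : ℝ) (f : ℝ → ℝ → ℂ) : ℝ≥0∞ :=
  (∑' ξ : ℤ, ∫⁻ τ : ℝ, ENNReal.ofReal
    (bracket (ξ : ℝ) ^ (2 * s) * bracket (τ - (ξ : ℝ) ^ 2) ^ (2 * b) *
      ‖fourierTX f τ ξ‖ ^ 2)) ^ (1 / 2 : ℝ)

end PeriodicBourgain

end

/-!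
By duality the estimate bounds a quadrilinear form in the moduli of Fourier transforms over the
quadruples `p₀ + p₃ = p₁ + p₂` of points `p = (ξ, τ)` of `ℤ × ℝ`. Here `u₃` enters through
`|𝓕u₃(-p₃)|`, which turns the weight of `X⁻` into that of `X`, so that all four modulations are
`σ = τ + ξ²`. They satisfy the resonance identity `σ₀ - σ₁ - σ₂ + σ₃ = 2 (ξ₀ - ξ₁) (ξ₀ - ξ₂)`,
while `ξ₀ ξ₃ = ξ₁ ξ₂ - (ξ₀ - ξ₁) (ξ₀ - ξ₂)`. Hence the ratio of the frequency weights, including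
the derivative on `u₃`, is bounded by a constant plus `⟨ξ₁⟩^(-1/2) ⟨ξ₂⟩^(-1/2) ∑ ⟨σⱼ⟩^(1/2)`, where
the second term is present only if `ξ₀ ≠ ξ₁` and `ξ₀ ≠ ξ₂`. Each resulting kernel is bounded by
Cauchy–Schwarz with `⟨σ⟩` raised only to the power `-49/100` instead of `-1/2`.

The remaining factor `⟨σ⟩^(-1/100)` gives the power of `T`: a function `g` supported in `[-T, T]`
satisfies `|ĝ|² ≤ (T / π) ‖g‖₂²`, so at least half of its `L²` mass lies in `|τ + ρ| ≥ π / (4 T)`,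
and therefore `‖g‖₂² ≤ 3 T ∫ ⟨τ + ρ⟩ |ĝ|²`.
-/

noncomputable section

namespace PeriodicBourgain

open MeasureTheory
open scoped NNReal SchwartzMap FourierTransform

/-! ### Powers of the bracket -/

theorem one_le_bracket (x : ℝ) : 1 ≤ bracket x := by
  rw [bracket, Real.one_le_sqrt]
  linarith [sq_nonneg |x|]

theorem bracket_pos (x : ℝ) : 0 < bracket x := one_pos.trans_le (one_le_bracket x)

theorem bracket_sq (x : ℝ) : bracket x ^ 2 = 1 + x ^ 2 := by
  rw [bracket, Real.sq_sqrt (by positivity), sq_abs]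

theorem bracket_neg (x : ℝ) : bracket (-x) = bracket x := by simp [bracket]

theorem abs_le_bracket (x : ℝ) : |x| ≤ bracket x :=
  abs_le_of_sq_le_sq (by rw [bracket_sq]; linarith) (bracket_pos x).le

theorem bracket_le_one_add_abs (x : ℝ) : bracket x ≤ 1 + |x| := by
  refine le_of_sq_le_sq ?_ (by positivity)
  rw [bracket_sq, ← sq_abs x]
  nlinarith [abs_nonneg x]

theorem bracket_mono {x y : ℝ} (h : |x| ≤ |y|) : bracket x ≤ bracket y := by
  unfold bracket
  gcongr

theorem bracket_le_mul_bracket {K : ℝ≥0} (hK : 1 ≤ K) {x y : ℝ} (h : |x| ≤ K * |y|) :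
    bracket x ≤ K * bracket y := by
  refine le_of_sq_le_sq ?_ (mul_nonneg K.coe_nonneg (bracket_pos y).le)
  have hsq : x ^ 2 ≤ K ^ 2 * y ^ 2 := by
    rw [← sq_abs x, ← sq_abs y, ← mul_pow]
    gcongr
  have hK1 : (1 : ℝ) ≤ (K : ℝ) ^ 2 := one_le_pow₀ (by exact_mod_cast hK)
  rw [mul_pow, bracket_sq, bracket_sq]
  linarith

theorem bracket_add_le (x y : ℝ) : bracket (x + y) ≤ bracket x + bracket y := by
  have hxy : x * y ≤ bracket x * bracket y := by
    calc x * y ≤ |x| * |y| := (le_abs_self _).trans_eq (abs_mul x y)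
      _ ≤ _ := mul_le_mul (abs_le_bracket x) (abs_le_bracket y) (abs_nonneg y) (bracket_pos x).le
  refine le_of_sq_le_sq ?_ (add_pos (bracket_pos x) (bracket_pos y)).le
  rw [add_sq (bracket x), bracket_sq, bracket_sq, bracket_sq]
  linarith

@[fun_prop]
theorem measurable_bracket : Measurable bracket := by
  unfold bracket
  fun_prop

/-- The power `⟨x⟩ ^ p` of the bracket, valued in `ℝ≥0∞` so that it can be integrated and summed
unconditionally. -/
def bracketPow (p x : ℝ) : ℝ≥0∞ := ENNReal.ofReal (bracket x ^ p)

@[fun_prop]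
theorem measurable_bracketPow (p : ℝ) : Measurable (bracketPow p) :=
  (measurable_bracket.pow_const p).ennreal_ofReal

theorem bracketPow_ne_top (p x : ℝ) : bracketPow p x ≠ ⊤ := ENNReal.ofReal_ne_top

theorem bracketPow_neg_arg (p x : ℝ) : bracketPow p (-x) = bracketPow p x := by
  rw [bracketPow, bracket_neg, bracketPow]

theorem bracketPow_sub_comm (p x y : ℝ) : bracketPow p (x - y) = bracketPow p (y - x) := by
  rw [← bracketPow_neg_arg, neg_sub]

theorem bracketPow_add (p q x : ℝ) :
    bracketPow (p + q) x = bracketPow p x * bracketPow q x := by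
  rw [bracketPow, Real.rpow_add (bracket_pos x),
    ENNReal.ofReal_mul (Real.rpow_nonneg (bracket_pos x).le p), bracketPow, bracketPow]

theorem bracketPow_zero (x : ℝ) : bracketPow 0 x = 1 := by simp [bracketPow]

theorem bracketPow_one (x : ℝ) : bracketPow 1 x = ENNReal.ofReal (bracket x) := by
  rw [bracketPow, Real.rpow_one]

theorem bracketPow_mul_bracketPow_neg (p x : ℝ) : bracketPow p x * bracketPow (-p) x = 1 := by
  rw [← bracketPow_add, add_neg_cancel, bracketPow_zero]

theorem bracketPow_sq (p x : ℝ) : bracketPow p x ^ 2 = bracketPow (2 * p) x := by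
  rw [two_mul, bracketPow_add, sq]

theorem bracketPow_mono {p q : ℝ} (h : p ≤ q) (x : ℝ) : bracketPow p x ≤ bracketPow q x :=
  ENNReal.ofReal_le_ofReal (Real.rpow_le_rpow_of_exponent_le (one_le_bracket x) h)

theorem bracketPow_neg_le_one {p : ℝ} (hp : 0 ≤ p) (x : ℝ) : bracketPow (-p) x ≤ 1 :=
  (bracketPow_mono (neg_nonpos.2 hp) x).trans_eq (bracketPow_zero x)

theorem bracketPow_le_of_bracket_le {p x y : ℝ} (hp : 0 ≤ p) (h : bracket x ≤ bracket y) :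
    bracketPow p x ≤ bracketPow p y :=
  ENNReal.ofReal_le_ofReal (Real.rpow_le_rpow (bracket_pos x).le h hp)

theorem bracketPow_neg_le_of_bracket_le {p x y : ℝ} (hp : 0 ≤ p) (h : bracket x ≤ bracket y) :
    bracketPow (-p) y ≤ bracketPow (-p) x :=
  ENNReal.ofReal_le_ofReal (Real.rpow_le_rpow_of_nonpos (bracket_pos x) h (by linarith))

theorem bracketPow_neg_le_mul_of_bracket_le {p : ℝ} {x y : ℝ} {K : ℝ≥0} (hp : 0 ≤ p)
    (h : bracket x ≤ K * bracket y) :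
    bracketPow (-p) y ≤ (K ^ p : ℝ≥0) * bracketPow (-p) x := by
  have hx := bracket_pos x
  have hy := bracket_pos y
  rw [bracketPow, bracketPow, ← ENNReal.ofReal_coe_nnreal,
    ← ENNReal.ofReal_mul (NNReal.coe_nonneg _), NNReal.coe_rpow]
  refine ENNReal.ofReal_le_ofReal ?_
  rw [Real.rpow_neg hy.le, Real.rpow_neg hx.le, inv_eq_one_div, ← div_eq_mul_inv,
    div_le_div_iff₀ (by positivity) (by positivity), one_mul,
    ← Real.mul_rpow K.coe_nonneg hy.le]
  exact Real.rpow_le_rpow hx.le h hp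

theorem bracketPow_mul_le_of_bracket_le {p q p' q' x y : ℝ} (h : p + q = p' + q') (hp : p ≤ p')
    (hxy : bracket x ≤ bracket y) :
    bracketPow (-p) x * bracketPow (-q) y ≤ bracketPow (-p') x * bracketPow (-q') y := by
  have hx : bracketPow (-p) x = bracketPow (-p') x * bracketPow (p' - p) x := by
    rw [← bracketPow_add]
    ring_nf
  have hy : bracketPow (-q') y = bracketPow (p' - p) y * bracketPow (-q) y := by
    rw [← bracketPow_add]
    congr 1
    linarith
  rw [hx, hy, mul_assoc]
  gcongr
  exact bracketPow_le_of_bracket_le (by linarith) hxy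

theorem bracketPow_mul_le_add {p q p' q' : ℝ} (h : p + q = p' + q') (hp : p ≤ p') (hq : q' ≤ p)
    (x y : ℝ) :
    bracketPow (-p) x * bracketPow (-q) y ≤
      bracketPow (-p') x * bracketPow (-q') y + bracketPow (-q') x * bracketPow (-p') y := by
  rcases le_total (bracket x) (bracket y) with hxy | hxy
  · exact (bracketPow_mul_le_of_bracket_le h hp hxy).trans le_self_add
  · refine le_trans ?_ le_add_self
    rw [mul_comm, mul_comm (bracketPow (-q') x)]
    exact bracketPow_mul_le_of_bracket_le (by linarith) (by linarith) hxy

theorem bracketPow_mul_le_bracketPow_add {p q : ℝ} (hp : 0 ≤ p) (hq : 0 ≤ q) (x y : ℝ) :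
    bracketPow (-p) x * bracketPow (-q) y ≤ bracketPow (-(p + q)) x + bracketPow (-(p + q)) y := by
  simpa [bracketPow_zero] using
    bracketPow_mul_le_add (p := p) (q := q) (p' := p + q) (q' := 0) (by ring) (by linarith) hp x y

theorem bracketPow_mul_le_sub_mul_add_of_bracket_le {p q r : ℝ} (hr : 0 ≤ r) (hp : 0 ≤ p)
    (hrq : r ≤ q) {x y : ℝ} (hxy : bracket x ≤ bracket y) :
    bracketPow (-p) x * bracketPow (-q) y ≤ (2 ^ r : ℝ≥0) * bracketPow (-r) (x - y) *
      (bracketPow (-(p + q - r)) x + bracketPow (-(p + q - r)) y) := by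
  have hsub : bracket (x - y) ≤ (2 : ℝ≥0) * bracket y := by
    have := bracket_add_le x (-y)
    rw [bracket_neg, ← sub_eq_add_neg] at this
    rw [NNReal.coe_ofNat]
    linarith
  calc bracketPow (-p) x * bracketPow (-q) y
      = bracketPow (-r) y * (bracketPow (-p) x * bracketPow (-(q - r)) y) := by
        rw [show -q = -r + -(q - r) by ring, bracketPow_add]
        ring
    _ ≤ _ := by
        rw [add_sub_assoc]
        gcongr
        · exact bracketPow_neg_le_mul_of_bracket_le hr hsub
        · exact bracketPow_mul_le_bracketPow_add hp (by linarith) x y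

theorem bracketPow_mul_le_sub_mul_add {p q r : ℝ} (hr : 0 ≤ r) (hrp : r ≤ p) (hrq : r ≤ q)
    (x y : ℝ) :
    bracketPow (-p) x * bracketPow (-q) y ≤ (2 ^ r : ℝ≥0) * bracketPow (-r) (x - y) *
      (bracketPow (-(p + q - r)) x + bracketPow (-(p + q - r)) y) := by
  rcases le_total (bracket x) (bracket y) with hxy | hxy
  · exact bracketPow_mul_le_sub_mul_add_of_bracket_le hr (hr.trans hrp) hrq hxy
  · rw [mul_comm, bracketPow_sub_comm, add_comm, add_comm p]
    exact bracketPow_mul_le_sub_mul_add_of_bracket_le hr (hr.trans hrq) hrp hxy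

/-! ### Integrals and sums of powers of the bracket -/

theorem lintegral_bracketPow_lt_top {p : ℝ} (hp : 1 < p) : ∫⁻ x : ℝ, bracketPow (-p) x < ⊤ := by
  have hint := integrable_rpow_neg_one_add_norm_sq (E := ℝ) (μ := volume) (r := p)
    (by simpa using hp)
  refine lt_of_eq_of_lt (lintegral_congr fun x => ?_) hint.lintegral_lt_top
  rw [bracketPow, bracket, Real.sqrt_eq_rpow, ← Real.rpow_mul (by positivity), Real.norm_eq_abs]
  ring_nf

theorem lintegral_bracketPow_add (p a : ℝ) :
    ∫⁻ x : ℝ, bracketPow p (x + a) = ∫⁻ x : ℝ, bracketPow p x :=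
  lintegral_add_right_eq_self (bracketPow p) a

theorem exists_lintegral_bracketPow_mul_le {p q r : ℝ} (hr : 0 ≤ r) (hrp : r ≤ p) (hrq : r ≤ q)
    (h : 1 < p + q - r) :
    ∃ C : ℝ≥0, ∀ a b : ℝ,
      ∫⁻ x : ℝ, bracketPow (-p) (x + a) * bracketPow (-q) (x + b) ≤
        C * bracketPow (-r) (a - b) := by
  lift ∫⁻ x : ℝ, bracketPow (-(p + q - r)) x to ℝ≥0 using (lintegral_bracketPow_lt_top h).ne
    with I hI
  refine ⟨2 ^ r * (2 * I), fun a b => ?_⟩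
  calc ∫⁻ x : ℝ, bracketPow (-p) (x + a) * bracketPow (-q) (x + b)
      ≤ ∫⁻ x : ℝ, (2 ^ r : ℝ≥0) * bracketPow (-r) (a - b) *
          (bracketPow (-(p + q - r)) (x + a) + bracketPow (-(p + q - r)) (x + b)) := by
        refine lintegral_mono fun x => ?_
        simpa only [add_sub_add_left_eq_sub] using
          bracketPow_mul_le_sub_mul_add hr hrp hrq (x + a) (x + b)
    _ = (2 ^ r : ℝ≥0) * bracketPow (-r) (a - b) * (I + I) := by
        rw [lintegral_const_mul _ (by fun_prop), lintegral_add_left (by fun_prop),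
          lintegral_bracketPow_add, lintegral_bracketPow_add, hI]
    _ = _ := by
        push_cast
        ring

theorem tsum_bracketPow_lt_top {p : ℝ} (hp : 1 < p) : ∑' n : ℤ, bracketPow (-p) n < ⊤ := by
  have hle (n : ℤ) :
      bracketPow (-p) n ≤ ENNReal.ofReal (|(n : ℝ)| ^ (-p)) + if n = 0 then 1 else 0 := by
    by_cases hn : n = 0
    · rw [if_pos hn]
      exact ((bracketPow_mono (by linarith) _).trans_eq (bracketPow_zero _)).trans le_add_self
    · exact (ENNReal.ofReal_le_ofReal (Real.rpow_le_rpow_of_nonpos (by simpa using hn)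
        (abs_le_bracket _) (by linarith))).trans le_self_add
  refine (ENNReal.tsum_le_tsum hle).trans_lt ?_
  rw [ENNReal.tsum_add, tsum_ite_eq]
  have := (Real.summable_abs_int_rpow hp).tsum_ofReal_lt_top
  finiteness

theorem bracketPow_neg_le_of_abs_sub_le_one {p : ℝ} (hp : 0 ≤ p) {x y : ℝ} (h : |x - y| ≤ 1) :
    bracketPow (-p) x ≤ (3 ^ p : ℝ≥0) * bracketPow (-p) y := by
  refine bracketPow_neg_le_mul_of_bracket_le hp ?_
  have hadd := bracket_add_le x (-(x - y))
  have hle := bracket_le_one_add_abs (x - y)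
  rw [bracket_neg, ← sub_eq_add_neg, sub_sub_cancel] at hadd
  rw [NNReal.coe_ofNat]
  linarith [one_le_bracket x]

theorem exists_tsum_bracketPow_add_le {p : ℝ} (hp : 1 < p) :
    ∃ C : ℝ≥0, ∀ D : ℝ, ∑' n : ℤ, bracketPow (-p) (n + D) ≤ C := by
  lift ∑' n : ℤ, bracketPow (-p) n to ℝ≥0 using (tsum_bracketPow_lt_top hp).ne with S hS
  refine ⟨3 ^ p * S, fun D => ?_⟩
  calc ∑' n : ℤ, bracketPow (-p) (n + D)
      ≤ ∑' n : ℤ, (3 ^ p : ℝ≥0) * bracketPow (-p) ((n + ⌊D⌋ : ℤ) : ℝ) := by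
        refine ENNReal.tsum_le_tsum fun n => bracketPow_neg_le_of_abs_sub_le_one (by linarith) ?_
        rw [Int.cast_add, add_sub_add_left_eq_sub, Int.self_sub_floor, Int.abs_fract]
        exact (Int.fract_lt_one D).le
    _ = (3 ^ p : ℝ≥0) * ∑' n : ℤ, bracketPow (-p) n := by
        rw [ENNReal.tsum_mul_left]
        exact congrArg _ ((Equiv.addRight ⌊D⌋).tsum_eq fun n : ℤ => bracketPow (-p) n)
    _ = _ := by rw [← hS, ENNReal.coe_mul]

theorem bracketPow_le_mul_of_sq_le {r : ℝ} (hr : 0 ≤ r) {w z : ℝ} (h : z ^ 2 ≤ |w|) :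
    bracketPow (-r) w ≤ (2 ^ r : ℝ≥0) * bracketPow (-(2 * r)) z := by
  have hz := bracket_pos z
  have hw := bracket_pos w
  have hle : bracket z ^ 2 ≤ 2 * bracket w := by
    rw [bracket_sq]
    linarith [abs_le_bracket w, one_le_bracket w]
  rw [bracketPow, bracketPow, ← ENNReal.ofReal_coe_nnreal,
    ← ENNReal.ofReal_mul (NNReal.coe_nonneg _), NNReal.coe_rpow, NNReal.coe_ofNat]
  refine ENNReal.ofReal_le_ofReal ?_
  rw [← mul_neg, Real.rpow_mul hz.le, Real.rpow_two, Real.rpow_neg hw.le,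
    Real.rpow_neg (by positivity), inv_eq_one_div, ← div_eq_mul_inv,
    div_le_div_iff₀ (by positivity) (by positivity), one_mul, ← Real.mul_rpow two_pos.le hw.le]
  exact Real.rpow_le_rpow (by positivity) hle hr

theorem bracketPow_sq_sub_sq_le {r D : ℝ} (hr : 0 ≤ r) (hD : 0 ≤ D) (y : ℝ) :
    bracketPow (-r) (y ^ 2 - D ^ 2) ≤
      (2 ^ r : ℝ≥0) * (bracketPow (-(2 * r)) (y - D) + bracketPow (-(2 * r)) (y + D)) := by
  rw [mul_add, sq_sub_sq]
  rcases le_total 0 y with hy | hy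
  · refine (bracketPow_le_mul_of_sq_le hr ?_).trans le_self_add
    rw [abs_mul, ← sq_abs (y - D), sq]
    gcongr ?_ * _
    rw [abs_of_nonneg (by linarith : 0 ≤ y + D), abs_le]
    constructor <;> linarith
  · refine (bracketPow_le_mul_of_sq_le hr ?_).trans le_add_self
    rw [abs_mul, ← sq_abs (y + D), sq]
    gcongr _ * ?_
    rw [abs_of_nonpos (by linarith : y - D ≤ 0), abs_le]
    constructor <;> linarith

theorem exists_tsum_bracketPow_add_sq_le {r : ℝ} (hr : 1 / 2 < r) :
    ∃ C : ℝ≥0, ∀ A : ℝ, ∑' n : ℤ, bracketPow (-r) (A + (n : ℝ) ^ 2) ≤ C := by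
  obtain ⟨C, hC⟩ := exists_tsum_bracketPow_add_le (p := 2 * r) (by linarith)
  refine ⟨2 ^ r * (C + C), fun A => ?_⟩
  set D := √(max (-A) 0)
  have hD2 : D ^ 2 = max (-A) 0 := Real.sq_sqrt (le_max_right _ _)
  have hle (n : ℤ) : bracketPow (-r) (A + (n : ℝ) ^ 2) ≤
      (2 ^ r : ℝ≥0) * (bracketPow (-(2 * r)) (n + -D) + bracketPow (-(2 * r)) (n + D)) := by
    refine (bracketPow_neg_le_of_bracket_le (by linarith) (bracket_mono ?_)).trans
      (bracketPow_sq_sub_sq_le (by linarith) (Real.sqrt_nonneg _) n)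
    rw [hD2]
    rcases le_total A 0 with hA | hA
    · rw [max_eq_left (by linarith), sub_neg_eq_add, add_comm]
    · rw [max_eq_right (by linarith), sub_zero, abs_of_nonneg (sq_nonneg _),
        abs_of_nonneg (by positivity)]
      linarith
  calc ∑' n : ℤ, bracketPow (-r) (A + (n : ℝ) ^ 2)
      ≤ _ := ENNReal.tsum_le_tsum hle
    _ = (2 ^ r : ℝ≥0) * (∑' n : ℤ, bracketPow (-(2 * r)) (n + -D) +
          ∑' n : ℤ, bracketPow (-(2 * r)) (n + D)) := by
        rw [ENNReal.tsum_mul_left, ENNReal.tsum_add]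
    _ ≤ (2 ^ r : ℝ≥0) * (C + C) := by gcongr <;> exact hC _
    _ = _ := by push_cast; rfl

theorem exists_tsum_bracketPow_quadratic_le {r : ℝ} (hr : 1 / 2 < r) :
    ∃ C : ℝ≥0, ∀ (A : ℝ) (h : ℤ),
      ∑' k : ℤ, bracketPow (-r) (A + 2 * (k : ℝ) ^ 2 + 2 * h * k) ≤ C := by
  obtain ⟨C, hC⟩ := exists_tsum_bracketPow_add_sq_le hr
  refine ⟨2 ^ r * C, fun A h => ?_⟩
  have hinj : Function.Injective (fun k : ℤ => 2 * k + h) := fun a b hab => by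
    simp only at hab
    omega
  -- completing the square: `2 * (A + 2 k² + 2 h k) = 2 A - h² + (2 k + h)²`
  calc ∑' k : ℤ, bracketPow (-r) (A + 2 * (k : ℝ) ^ 2 + 2 * h * k)
      ≤ ∑' k : ℤ, (2 ^ r : ℝ≥0) *
          bracketPow (-r) (2 * A - (h : ℝ) ^ 2 + ((2 * k + h : ℤ) : ℝ) ^ 2) := by
        refine ENNReal.tsum_le_tsum fun k =>
          bracketPow_neg_le_mul_of_bracket_le (by linarith) ?_
        refine bracket_le_mul_bracket one_le_two (le_of_eq ?_)
        rw [← NNReal.abs_eq, ← abs_mul, NNReal.coe_ofNat]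
        push_cast
        ring_nf
    _ = (2 ^ r : ℝ≥0) * ∑' k : ℤ,
          bracketPow (-r) (2 * A - (h : ℝ) ^ 2 + ((2 * k + h : ℤ) : ℝ) ^ 2) :=
        ENNReal.tsum_mul_left
    _ ≤ (2 ^ r : ℝ≥0) * C := by
        gcongr
        exact (ENNReal.tsum_comp_le_tsum_of_injective hinj
          fun n : ℤ => bracketPow (-r) (2 * A - (h : ℝ) ^ 2 + (n : ℝ) ^ 2)).trans (hC _)
    _ = _ := (ENNReal.coe_mul _ _).symm

theorem exists_tsum_bracketPow_mul_linear_le {p r : ℝ} (hp : 0 ≤ p) (hr : 0 ≤ r)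
    (hpr : 1 < p + r) :
    ∃ C : ℝ≥0, ∀ (A : ℝ) (b : ℤ), b ≠ 0 →
      ∑' k : ℤ, bracketPow (-p) k * bracketPow (-r) (A + 2 * b * k) ≤ C := by
  obtain ⟨C, hC⟩ := exists_tsum_bracketPow_add_le hpr
  refine ⟨C + C, fun A b hb => ?_⟩
  have hb0 : (b : ℝ) ≠ 0 := by exact_mod_cast hb
  have hb1 : (1 : ℝ) ≤ |(b : ℝ)| := by exact_mod_cast Int.one_le_abs hb
  have hlin (k : ℤ) : |(k : ℝ) + A / (2 * b)| ≤ |A + 2 * b * k| := by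
    have hfac : A + 2 * b * k = (2 * b) * (k + A / (2 * b)) := by
      field_simp
      ring
    rw [hfac, abs_mul]
    refine le_mul_of_one_le_left (abs_nonneg _) ?_
    rw [abs_mul, abs_two]
    linarith
  calc ∑' k : ℤ, bracketPow (-p) k * bracketPow (-r) (A + 2 * b * k)
      ≤ ∑' k : ℤ, (bracketPow (-(p + r)) (k + 0) + bracketPow (-(p + r)) (k + A / (2 * b))) := by
        refine ENNReal.tsum_le_tsum fun k => ?_
        rw [add_zero]
        exact (mul_le_mul_right (bracketPow_neg_le_of_bracket_le hr (bracket_mono (hlin k)))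
          _).trans (bracketPow_mul_le_bracketPow_add hp hr _ _)
    _ ≤ C + C := by
        rw [ENNReal.tsum_add]
        exact add_le_add (hC _) (hC _)
    _ = _ := (ENNReal.coe_add _ _).symm

/-! ### Quadrilinear forms on an abelian group -/

theorem sq_lintegral_mul_le {α : Type*} [MeasurableSpace α] (μ : Measure α) {f g : α → ℝ≥0∞}
    (hf : AEMeasurable f μ) (hg : AEMeasurable g μ) :
    (∫⁻ x, f x * g x ∂μ) ^ 2 ≤ (∫⁻ x, f x ^ 2 ∂μ) * ∫⁻ x, g x ^ 2 ∂μ := by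
  have h := ENNReal.lintegral_mul_le_Lp_mul_Lq μ Real.HolderConjugate.two_two hf hg
  simp only [ENNReal.rpow_two, Pi.mul_apply] at h
  refine (pow_le_pow_left' h 2).trans_eq ?_
  rw [mul_pow, ← ENNReal.rpow_two, ← ENNReal.rpow_two, ← ENNReal.rpow_mul, ← ENNReal.rpow_mul]
  norm_num

/-- The square of the `L²` norm of a nonnegative function. -/
def sqNorm {α : Type*} [MeasurableSpace α] (μ : Measure α) (f : α → ℝ≥0∞) : ℝ≥0∞ :=
  ∫⁻ p, f p ^ 2 ∂μ

section QuadForm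

variable {G : Type*}

/-- The symmetry `p₁ ↔ p₂` of the constraint `p₀ + p₃ = p₁ + p₂`. -/
def swapOneTwo (z : G × G × G) : G × G × G := (z.1, z.2.2, z.2.1)

theorem measurePreserving_swapOneTwo [MeasurableSpace G] {μ : Measure G} [SFinite μ] :
    MeasurePreserving swapOneTwo (μ.prod (μ.prod μ)) (μ.prod (μ.prod μ)) :=
  (MeasurePreserving.id μ).prod Measure.measurePreserving_swap

variable [AddCommGroup G]

/-- The frequency `p₃` determined by `z = (p₀, p₁, p₂)` and the constraint `p₀ + p₃ = p₁ + p₂`. -/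
def freqThree (z : G × G × G) : G := z.2.1 + z.2.2 - z.1

/-- The symmetry `p₀ ↔ p₃` of the constraint `p₀ + p₃ = p₁ + p₂`. -/
def swapZeroThree (z : G × G × G) : G × G × G := (freqThree z, z.2)

/-- The symmetry `(p₀, p₃) ↔ (p₁, p₂)` of the constraint `p₀ + p₃ = p₁ + p₂`. -/
def swapPairs (z : G × G × G) : G × G × G := (z.2.1, z.1, freqThree z)

theorem freqThree_swapZeroThree (z : G × G × G) : freqThree (swapZeroThree z) = z.1 :=
  sub_sub_cancel _ _

theorem freqThree_swapOneTwo (z : G × G × G) : freqThree (swapOneTwo z) = freqThree z :=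
  congrArg (· - z.1) (add_comm z.2.2 z.2.1)

theorem freqThree_swapPairs (z : G × G × G) : freqThree (swapPairs z) = z.2.2 := by
  simp only [freqThree, swapPairs]
  abel

variable [MeasurableSpace G]

/-- The quadrilinear form with kernel `K` over the frequencies `p₀ + p₃ = p₁ + p₂`. -/
def quadForm (μ : Measure G) (f₀ f₁ f₂ f₃ : G → ℝ≥0∞) (K : G × G × G → ℝ≥0∞) : ℝ≥0∞ :=
  ∫⁻ z, f₀ z.1 * (f₁ z.2.1 * (f₂ z.2.2 * f₃ (freqThree z))) * K z ∂(μ.prod (μ.prod μ))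

/-- A kernel whose quadrilinear form is bounded on `L²`, in squared form. -/
structure IsBoundedKernel (μ : Measure G) (K : G × G × G → ℝ≥0∞) : Prop where
  measurable : Measurable K
  bound : ∃ C : ℝ≥0, ∀ f₀ f₁ f₂ f₃ : G → ℝ≥0∞, Measurable f₀ → Measurable f₁ → Measurable f₂ →
    Measurable f₃ →
    quadForm μ f₀ f₁ f₂ f₃ K ^ 2 ≤ C * (sqNorm μ f₀ * (sqNorm μ f₁ * sqNorm μ f₂ * sqNorm μ f₃))

variable {μ : Measure G} {f₀ f₁ f₂ f₃ : G → ℝ≥0∞} {K L : G × G × G → ℝ≥0∞}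

theorem quadForm_mono (h : ∀ z, K z ≤ L z) :
    quadForm μ f₀ f₁ f₂ f₃ K ≤ quadForm μ f₀ f₁ f₂ f₃ L :=
  lintegral_mono fun z => mul_le_mul_right (h z) _

theorem IsBoundedKernel.mono (hL : IsBoundedKernel μ L) (hK : Measurable K)
    (h : ∀ z, K z ≤ L z) : IsBoundedKernel μ K := by
  obtain ⟨C, hC⟩ := hL.bound
  exact ⟨hK, C, fun f₀ f₁ f₂ f₃ h₀ h₁ h₂ h₃ =>
    (pow_le_pow_left' (quadForm_mono h) 2).trans (hC _ _ _ _ h₀ h₁ h₂ h₃)⟩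

theorem add_sq_le_two_mul_sq_add_sq (a b : ℝ≥0∞) : (a + b) ^ 2 ≤ 2 * (a ^ 2 + b ^ 2) := by
  have h := ENNReal.rpow_add_le_mul_rpow_add_rpow a b (p := 2) one_le_two
  norm_num at h
  exact h

variable [MeasurableAdd₂ G] [MeasurableNeg G]

@[fun_prop]
theorem measurable_freqThree : Measurable (freqThree : G × G × G → G) := by
  unfold freqThree
  fun_prop

theorem quadForm_add (h₀ : Measurable f₀) (h₁ : Measurable f₁) (h₂ : Measurable f₂)
    (h₃ : Measurable f₃) (hK : Measurable K) :
    quadForm μ f₀ f₁ f₂ f₃ (K + L) = quadForm μ f₀ f₁ f₂ f₃ K + quadForm μ f₀ f₁ f₂ f₃ L := by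
  simp only [quadForm, Pi.add_apply, mul_add]
  exact lintegral_add_left (by fun_prop) _

theorem IsBoundedKernel.add (hK : IsBoundedKernel μ K) (hL : IsBoundedKernel μ L) :
    IsBoundedKernel μ (K + L) := by
  obtain ⟨C, hC⟩ := hK.bound
  obtain ⟨D, hD⟩ := hL.bound
  refine ⟨hK.measurable.add hL.measurable, 2 * (C + D), fun f₀ f₁ f₂ f₃ h₀ h₁ h₂ h₃ => ?_⟩
  rw [quadForm_add h₀ h₁ h₂ h₃ hK.measurable, ENNReal.coe_mul, ENNReal.coe_add, mul_assoc, add_mul]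
  exact (add_sq_le_two_mul_sq_add_sq _ _).trans
    (mul_le_mul_right (add_le_add (hC _ _ _ _ h₀ h₁ h₂ h₃) (hD _ _ _ _ h₀ h₁ h₂ h₃)) _)

variable [SFinite μ]

theorem quadForm_swapOneTwo (h₀ : Measurable f₀) (h₁ : Measurable f₁) (h₂ : Measurable f₂)
    (h₃ : Measurable f₃) (hK : Measurable K) :
    quadForm μ f₀ f₁ f₂ f₃ K = quadForm μ f₀ f₂ f₁ f₃ (K ∘ swapOneTwo) := by
  rw [quadForm, quadForm, ← (measurePreserving_swapOneTwo (μ := μ)).lintegral_comp (by fun_prop)]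
  refine lintegral_congr fun z => ?_
  rw [freqThree_swapOneTwo, mul_left_comm (f₁ _)]
  rfl

theorem IsBoundedKernel.swapOneTwo (hK : IsBoundedKernel μ K) :
    IsBoundedKernel μ (K ∘ swapOneTwo) := by
  obtain ⟨C, hC⟩ := hK.bound
  refine ⟨hK.measurable.comp (measurePreserving_swapOneTwo (μ := μ)).measurable, C,
    fun f₀ f₁ f₂ f₃ h₀ h₁ h₂ h₃ => ?_⟩
  rw [← quadForm_swapOneTwo h₀ h₂ h₁ h₃ hK.measurable, mul_comm (sqNorm μ f₁)]
  exact hC _ _ _ _ h₀ h₂ h₁ h₃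

theorem lintegral_sq_mul_pair_le {k : G × G → ℝ≥0∞} (h₁ : Measurable f₁) (h₂ : Measurable f₂)
    (hk : Measurable k) {C : ℝ≥0∞} (hC : ∀ s, ∫⁻ p, k (p, s - p) ^ 2 ∂μ ≤ C) :
    ∫⁻ z : G × G × G, (f₁ z.2.1 * f₂ z.2.2 * k (z.1, freqThree z)) ^ 2 ∂(μ.prod (μ.prod μ)) ≤
      C * (sqNorm μ f₁ * sqNorm μ f₂) := by
  rw [lintegral_prod_symm _ (by fun_prop), sqNorm, sqNorm,
    ← lintegral_prod_mul (by fun_prop) (by fun_prop), ← lintegral_const_mul _ (by fun_prop)]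
  refine lintegral_mono fun q => ?_
  simp only [mul_pow, freqThree]
  rw [lintegral_const_mul _ (by fun_prop), mul_comm]
  exact mul_le_mul_left (hC _) _

variable [μ.IsAddLeftInvariant]

theorem measurePreserving_swapPairs :
    MeasurePreserving swapPairs (μ.prod (μ.prod μ)) (μ.prod (μ.prod μ)) := by
  have hskew : MeasurePreserving (fun z : (G × G) × G => (z.1.swap, z.1.2 - z.1.1 + z.2))
      ((μ.prod μ).prod μ) ((μ.prod μ).prod μ) :=
    Measure.measurePreserving_swap.skew_product (g := fun (p : G × G) x => p.2 - p.1 + x)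
      (by fun_prop)
      (Filter.Eventually.of_forall fun p => (measurePreserving_add_left μ (p.2 - p.1)).map_eq)
  have hassoc := measurePreserving_prodAssoc μ μ μ
  convert (hassoc.comp hskew).comp (hassoc.symm _) using 1
  ext z : 1
  exact Prod.ext rfl (Prod.ext rfl (add_sub_right_comm _ _ _))

theorem quadForm_swapPairs (h₀ : Measurable f₀) (h₁ : Measurable f₁) (h₂ : Measurable f₂)
    (h₃ : Measurable f₃) (hK : Measurable K) :
    quadForm μ f₀ f₁ f₂ f₃ K = quadForm μ f₁ f₀ f₃ f₂ (K ∘ swapPairs) := by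
  rw [quadForm, quadForm, ← (measurePreserving_swapPairs (μ := μ)).lintegral_comp (by fun_prop)]
  refine lintegral_congr fun z => ?_
  rw [freqThree_swapPairs, mul_left_comm (f₀ _), mul_comm (f₂ _)]
  rfl

theorem IsBoundedKernel.swapPairs (hK : IsBoundedKernel μ K) :
    IsBoundedKernel μ (K ∘ swapPairs) := by
  obtain ⟨C, hC⟩ := hK.bound
  refine ⟨hK.measurable.comp (measurePreserving_swapPairs (μ := μ)).measurable, C,
    fun f₀ f₁ f₂ f₃ h₀ h₁ h₂ h₃ => ?_⟩
  rw [← quadForm_swapPairs h₁ h₀ h₃ h₂ hK.measurable]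
  exact (hC _ _ _ _ h₁ h₀ h₃ h₂).trans_eq (by ring)

theorem isBoundedKernel_mul_of_lintegral_sq_le {k l : G × G → ℝ≥0∞} (hk : Measurable k)
    (hl : Measurable l) {C D : ℝ≥0} (hC : ∀ s, ∫⁻ p, k (p, s - p) ^ 2 ∂μ ≤ C)
    (hD : ∀ s, ∫⁻ p, l (p, s - p) ^ 2 ∂μ ≤ D) :
    IsBoundedKernel μ fun z => k (z.1, freqThree z) * l z.2 := by
  refine ⟨by fun_prop, D * C, fun f₀ f₁ f₂ f₃ h₀ h₁ h₂ h₃ => ?_⟩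
  have hl' : ∫⁻ z : G × G × G, (f₀ z.1 * f₃ (freqThree z) * l z.2) ^ 2 ∂(μ.prod (μ.prod μ)) ≤
      D * (sqNorm μ f₀ * sqNorm μ f₃) := by
    rw [← (measurePreserving_swapPairs (μ := μ)).lintegral_comp (by fun_prop)]
    simp only [freqThree_swapPairs]
    exact lintegral_sq_mul_pair_le h₀ h₃ hl hD
  calc quadForm μ f₀ f₁ f₂ f₃ (fun z => k (z.1, freqThree z) * l z.2) ^ 2
      = (∫⁻ z : G × G × G, (f₀ z.1 * f₃ (freqThree z) * l z.2) *
          (f₁ z.2.1 * f₂ z.2.2 * k (z.1, freqThree z)) ∂(μ.prod (μ.prod μ))) ^ 2 :=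
        congrArg (· ^ 2) (lintegral_congr fun z => by ring)
    _ ≤ (D * (sqNorm μ f₀ * sqNorm μ f₃)) * (C * (sqNorm μ f₁ * sqNorm μ f₂)) :=
        (sq_lintegral_mul_le _ (by fun_prop) (by fun_prop)).trans
          (mul_le_mul' hl' (lintegral_sq_mul_pair_le h₁ h₂ hk hC))
    _ = _ := by
        push_cast
        ring

variable [μ.IsNegInvariant]

theorem measurePreserving_swapZeroThree :
    MeasurePreserving swapZeroThree (μ.prod (μ.prod μ)) (μ.prod (μ.prod μ)) := by
  have hskew : MeasurePreserving (fun z : (G × G) × G => (id z.1, z.1.1 + z.1.2 - z.2))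
      ((μ.prod μ).prod μ) ((μ.prod μ).prod μ) :=
    (MeasurePreserving.id _).skew_product (g := fun (p : G × G) x => p.1 + p.2 - x) (by fun_prop)
      (Filter.Eventually.of_forall fun p => Measure.map_sub_left_eq_self μ (p.1 + p.2))
  exact (Measure.measurePreserving_swap.comp hskew).comp Measure.measurePreserving_swap

theorem quadForm_swapZeroThree (h₀ : Measurable f₀) (h₁ : Measurable f₁) (h₂ : Measurable f₂)
    (h₃ : Measurable f₃) (hK : Measurable K) :
    quadForm μ f₀ f₁ f₂ f₃ K = quadForm μ f₃ f₁ f₂ f₀ (K ∘ swapZeroThree) := by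
  rw [quadForm, quadForm, ← (measurePreserving_swapZeroThree (μ := μ)).lintegral_comp (by fun_prop)]
  refine lintegral_congr fun z => ?_
  rw [freqThree_swapZeroThree, Function.comp_apply]
  simp only [swapZeroThree]
  ring

theorem IsBoundedKernel.swapZeroThree (hK : IsBoundedKernel μ K) :
    IsBoundedKernel μ (K ∘ swapZeroThree) := by
  obtain ⟨C, hC⟩ := hK.bound
  refine ⟨hK.measurable.comp (measurePreserving_swapZeroThree (μ := μ)).measurable, C,
    fun f₀ f₁ f₂ f₃ h₀ h₁ h₂ h₃ => ?_⟩
  rw [← quadForm_swapZeroThree h₃ h₁ h₂ h₀ hK.measurable]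
  exact (hC _ _ _ _ h₃ h₁ h₂ h₀).trans_eq (by ring)

theorem sqNorm_triple (h₁ : Measurable f₁) (h₂ : Measurable f₂) (h₃ : Measurable f₃) :
    sqNorm (μ.prod (μ.prod μ)) (fun z => f₁ z.2.1 * (f₂ z.2.2 * f₃ (freqThree z))) =
      sqNorm μ f₁ * sqNorm μ f₂ * sqNorm μ f₃ := by
  rw [sqNorm, ← (measurePreserving_swapZeroThree (μ := μ)).lintegral_comp (by fun_prop)]
  simp only [freqThree_swapZeroThree]
  calc ∫⁻ z : G × G × G, (f₁ z.2.1 * (f₂ z.2.2 * f₃ z.1)) ^ 2 ∂μ.prod (μ.prod μ)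
      = ∫⁻ z : G × G × G, f₃ z.1 ^ 2 * (f₁ z.2.1 ^ 2 * f₂ z.2.2 ^ 2) ∂μ.prod (μ.prod μ) :=
        lintegral_congr fun z => by ring
    _ = sqNorm μ f₃ * (sqNorm μ f₁ * sqNorm μ f₂) := by
        rw [sqNorm, sqNorm, sqNorm, ← lintegral_prod_mul (by fun_prop) (by fun_prop),
          ← lintegral_prod_mul (by fun_prop) (by fun_prop)]
    _ = _ := mul_comm _ _

theorem isBoundedKernel_of_lintegral_sq_le (hK : Measurable K) {C : ℝ≥0}
    (hC : ∀ p₀, ∫⁻ q, K (p₀, q) ^ 2 ∂(μ.prod μ) ≤ C) : IsBoundedKernel μ K := by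
  refine ⟨hK, C, fun f₀ f₁ f₂ f₃ h₀ h₁ h₂ h₃ => ?_⟩
  calc quadForm μ f₀ f₁ f₂ f₃ K ^ 2
      = (∫⁻ z, (f₀ z.1 * K z) * (f₁ z.2.1 * (f₂ z.2.2 * f₃ (freqThree z)))
          ∂(μ.prod (μ.prod μ))) ^ 2 := by
        simp only [quadForm, mul_right_comm]
    _ ≤ (∫⁻ z, (f₀ z.1 * K z) ^ 2 ∂(μ.prod (μ.prod μ))) *
          (sqNorm μ f₁ * sqNorm μ f₂ * sqNorm μ f₃) := by
        rw [← sqNorm_triple h₁ h₂ h₃]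
        exact sq_lintegral_mul_le _ (by fun_prop) (by fun_prop)
    _ ≤ (C * sqNorm μ f₀) * (sqNorm μ f₁ * sqNorm μ f₂ * sqNorm μ f₃) := by
        gcongr
        rw [lintegral_prod _ (by fun_prop), sqNorm, ← lintegral_const_mul _ (by fun_prop)]
        refine lintegral_mono fun p₀ => ?_
        simp only [mul_pow]
        rw [lintegral_const_mul _ (by fun_prop), mul_comm]
        exact mul_le_mul_left (hC p₀) _
    _ = _ := mul_assoc _ _ _

end QuadForm

/-! ### The frequency space -/

/-- The Plancherel measure on the frequency space `ℤ × ℝ`; a frequency is a pair `(ξ, τ)`. -/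
def freqMeasure : Measure (ℤ × ℝ) := Measure.count.prod volume

instance : SigmaFinite freqMeasure := by unfold freqMeasure; infer_instance

instance : freqMeasure.IsAddLeftInvariant := by unfold freqMeasure; infer_instance

instance : freqMeasure.IsNegInvariant where
  neg_eq_self := by
    have h := Measure.map_prod_map (Measure.count : Measure ℤ) (volume : Measure ℝ)
      measurable_neg measurable_neg
    rw [Measure.map_neg_eq_self, Measure.map_neg_eq_self] at h
    exact h.symm

theorem lintegral_freqMeasure {f : ℤ × ℝ → ℝ≥0∞} (hf : Measurable f) :
    ∫⁻ p, f p ∂freqMeasure = ∑' ξ : ℤ, ∫⁻ τ : ℝ, f (ξ, τ) := by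
  rw [freqMeasure, lintegral_prod _ hf.aemeasurable, lintegral_count]

theorem lintegral_freqMeasure_prod {f : (ℤ × ℝ) × (ℤ × ℝ) → ℝ≥0∞} (hf : Measurable f) :
    ∫⁻ q, f q ∂(freqMeasure.prod freqMeasure) =
      ∑' (ξ : ℤ) (η : ℤ), ∫⁻ (x : ℝ) (y : ℝ), f ((ξ, x), (η, y)) := by
  rw [lintegral_prod _ hf.aemeasurable, lintegral_freqMeasure hf.lintegral_prod_right']
  refine tsum_congr fun ξ => ?_
  rw [← lintegral_tsum fun η => Measurable.aemeasurable (Measurable.lintegral_prod_right'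
    (f := fun z : ℝ × ℝ => f ((ξ, z.1), (η, z.2))) (by fun_prop))]
  exact lintegral_congr fun x => lintegral_freqMeasure (by fun_prop)

/-- The modulation `τ + ξ²`, which vanishes on the characteristic curve of the Schrödinger
equation. -/
def modulation (p : ℤ × ℝ) : ℝ := p.2 + (p.1 : ℝ) ^ 2

@[fun_prop]
theorem measurable_modulation : Measurable modulation := by
  unfold modulation
  fun_prop

/-- The power `⟨τ + ξ²⟩ᵖ` of the bracket of the modulation. -/
def modPow (p : ℝ) (k : ℤ × ℝ) : ℝ≥0∞ := bracketPow p (modulation k)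

@[fun_prop]
theorem measurable_modPow (p : ℝ) : Measurable (modPow p) := by
  unfold modPow
  fun_prop

theorem modPow_sq (p : ℝ) (k : ℤ × ℝ) : modPow p k ^ 2 = modPow (2 * p) k := bracketPow_sq _ _

theorem exists_lintegral_modPow_mul_sub_le {p : ℝ} (hp : 3 / 4 < p) :
    ∃ C : ℝ≥0, ∀ s : ℤ × ℝ, ∫⁻ k, modPow (-p) k * modPow (-p) (s - k) ∂freqMeasure ≤ C := by
  obtain ⟨r, hr, hrp⟩ := exists_between (show 1 / 2 < min p (2 * p - 1) by
    rw [lt_min_iff]; constructor <;> linarith)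
  rw [lt_min_iff] at hrp
  obtain ⟨C, hC⟩ := exists_lintegral_bracketPow_mul_le (p := p) (q := p) (r := r)
    (by linarith) hrp.1.le hrp.1.le (by linarith)
  obtain ⟨D, hD⟩ := exists_tsum_bracketPow_quadratic_le hr
  refine ⟨C * D, fun s => ?_⟩
  rw [lintegral_freqMeasure (by fun_prop)]
  calc ∑' ξ : ℤ, ∫⁻ τ : ℝ, modPow (-p) (ξ, τ) * modPow (-p) (s - (ξ, τ))
      = ∑' ξ : ℤ, ∫⁻ τ : ℝ, bracketPow (-p) (τ + (ξ : ℝ) ^ 2) *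
          bracketPow (-p) (τ + (-s.2 - ((s.1 : ℝ) - ξ) ^ 2)) := by
        refine tsum_congr fun ξ => lintegral_congr fun τ => congrArg _ ?_
        rw [modPow, ← bracketPow_neg_arg]
        simp only [modulation, Prod.fst_sub, Prod.snd_sub, Int.cast_sub]
        ring_nf
    _ ≤ ∑' ξ : ℤ, C * bracketPow (-r)
          (s.2 + (s.1 : ℝ) ^ 2 + 2 * (ξ : ℝ) ^ 2 + 2 * (-s.1 : ℤ) * ξ) := by
        refine ENNReal.tsum_le_tsum fun ξ => (hC _ _).trans_eq ?_
        push_cast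
        ring_nf
    _ ≤ C * D := by
        rw [ENNReal.tsum_mul_left]
        exact mul_le_mul_right (hD _ _) _
    _ = _ := (ENNReal.coe_mul _ _).symm

theorem exists_lintegral_bracketPow_mul_modPow_sub_le {p q r : ℝ} (hp : 0 ≤ p) (hq : 0 ≤ q)
    (hpq : 1 < p + q) (hr : 1 < r) :
    ∃ C : ℝ≥0, ∀ s : ℤ × ℝ, ∫⁻ k : ℤ × ℝ, bracketPow (-p) k.1 *
      bracketPow (-q) (s - k).1 * modPow (-r) (s - k) ∂freqMeasure ≤ C := by
  obtain ⟨C, hC⟩ := exists_tsum_bracketPow_add_le hpq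
  lift ∫⁻ x : ℝ, bracketPow (-r) x to ℝ≥0 using (lintegral_bracketPow_lt_top hr).ne with I hI
  refine ⟨(C + C) * I, fun s => ?_⟩
  have hmod (ξ : ℤ) : ∫⁻ τ : ℝ, modPow (-r) (s - (ξ, τ)) = I := by
    rw [← lintegral_sub_left_eq_self _ s.2]
    simp only [modPow, modulation, Prod.fst_sub, Prod.snd_sub, sub_sub_cancel]
    rw [lintegral_bracketPow_add, hI]
  rw [lintegral_freqMeasure (by fun_prop)]
  calc ∑' ξ : ℤ, ∫⁻ τ : ℝ, bracketPow (-p) ξ * bracketPow (-q) (s - (ξ, τ)).1 *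
          modPow (-r) (s - (ξ, τ))
      = ∑' ξ : ℤ, bracketPow (-p) ξ * bracketPow (-q) (s.1 - ξ : ℤ) * I := by
        refine tsum_congr fun ξ => ?_
        rw [← hmod ξ, ← lintegral_const_mul _ (by fun_prop)]
        rfl
    _ ≤ ∑' ξ : ℤ, (bracketPow (-(p + q)) (ξ + 0) + bracketPow (-(p + q)) (ξ + -s.1)) * I := by
        refine ENNReal.tsum_le_tsum fun ξ => mul_le_mul_left ?_ _
        rw [add_zero, ← sub_eq_add_neg, bracketPow_sub_comm, ← Int.cast_sub]
        exact bracketPow_mul_le_bracketPow_add hp hq _ _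
    _ ≤ (C + C) * I := by
        rw [ENNReal.tsum_mul_right, ENNReal.tsum_add]
        exact mul_le_mul_left (add_le_add (hC _) (hC _)) _
    _ = _ := by
        push_cast
        rfl

theorem exists_lintegral_bracketPow_triple_le {p r : ℝ} (hp : p < 1) (hr : 0 ≤ r)
    (hrp : r < 3 * p - 2) :
    ∃ C : ℝ≥0, ∀ a b c : ℝ, ∫⁻ (x : ℝ) (y : ℝ),
      bracketPow (-p) (x + a) * (bracketPow (-p) (y + b) * bracketPow (-p) (x + y + c)) ≤
        C * bracketPow (-r) (a + b - c) := by
  obtain ⟨q, hrq, hqp⟩ := exists_between (show r + 1 - p < 2 * p - 1 by linarith)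
  obtain ⟨C, hC⟩ := exists_lintegral_bracketPow_mul_le (p := p) (q := p) (r := q)
    (by linarith) (by linarith) (by linarith) (by linarith)
  obtain ⟨D, hD⟩ := exists_lintegral_bracketPow_mul_le (p := p) (q := q) (r := r) hr
    (by linarith) (by linarith) (by linarith)
  refine ⟨C * D, fun a b c => ?_⟩
  have hinner (x : ℝ) : ∫⁻ y : ℝ, bracketPow (-p) (y + b) * bracketPow (-p) (x + y + c) ≤
      C * bracketPow (-q) (x + (c - b)) := by
    rw [← bracketPow_neg_arg]
    convert hC b (x + c) using 3 <;> ring_nf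
  calc ∫⁻ (x : ℝ) (y : ℝ),
        bracketPow (-p) (x + a) * (bracketPow (-p) (y + b) * bracketPow (-p) (x + y + c))
      ≤ ∫⁻ x : ℝ, C * (bracketPow (-p) (x + a) * bracketPow (-q) (x + (c - b))) := by
        refine lintegral_mono fun x => ?_
        rw [lintegral_const_mul _ (by fun_prop), mul_left_comm]
        exact mul_le_mul_right (hinner x) _
    _ ≤ C * (D * bracketPow (-r) (a - (c - b))) := by
        rw [lintegral_const_mul _ (by fun_prop)]
        exact mul_le_mul_right (hD _ _) _
    _ = _ := by
        rw [ENNReal.coe_mul, mul_assoc, sub_sub_eq_add_sub]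

/-! ### Kernels on the frequency space -/

/-- The kernel `w(ξ₀, ξ₁, ξ₂) ⟨σ₁⟩⁻ᵖ ⟨σ₂⟩⁻ᵖ ⟨σ₃⟩⁻ᵖ`, where `σⱼ` is the modulation of `pⱼ`. -/
def modKernel (p : ℝ) (w : ℤ → ℤ → ℤ → ℝ≥0∞) (z : (ℤ × ℝ) × (ℤ × ℝ) × (ℤ × ℝ)) : ℝ≥0∞ :=
  w z.1.1 z.2.1.1 z.2.2.1 * (modPow (-p) z.2.1 * (modPow (-p) z.2.2 * modPow (-p) (freqThree z)))

theorem measurable_modKernel (p : ℝ) (w : ℤ → ℤ → ℤ → ℝ≥0∞) : Measurable (modKernel p w) := by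
  have hw : Measurable fun v : ℤ × ℤ × ℤ => w v.1 v.2.1 v.2.2 := measurable_of_countable _
  exact Measurable.mul (hw.comp (g := fun v : ℤ × ℤ × ℤ => w v.1 v.2.1 v.2.2)
    (f := fun z : (ℤ × ℝ) × (ℤ × ℝ) × (ℤ × ℝ) => (z.1.1, z.2.1.1, z.2.2.1)) (by fun_prop))
    (by fun_prop)

theorem exists_lintegral_modKernel_sq_le {p r : ℝ} (hp : p < 1 / 2) (hr : 0 ≤ r)
    (hrp : r < 6 * p - 2) :
    ∃ C : ℝ≥0, ∀ (w : ℤ → ℤ → ℤ → ℝ≥0∞) (p₀ : ℤ × ℝ),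
      ∫⁻ q, modKernel p w (p₀, q) ^ 2 ∂(freqMeasure.prod freqMeasure) ≤
        C * ∑' (ξ : ℤ) (η : ℤ), w p₀.1 ξ η ^ 2 *
          bracketPow (-r) (2 * (ξ - p₀.1 : ℤ) * (η - p₀.1 : ℤ) - modulation p₀) := by
  obtain ⟨C, hC⟩ := exists_lintegral_bracketPow_triple_le (p := 2 * p) (r := r)
    (by linarith) hr (by linarith)
  refine ⟨C, fun w p₀ => ?_⟩
  have hm : Measurable fun q => modKernel p w (p₀, q) ^ 2 :=
    ((measurable_modKernel p w).comp measurable_prodMk_left).pow_const 2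
  rw [lintegral_freqMeasure_prod hm, ← ENNReal.tsum_mul_left]
  refine ENNReal.tsum_le_tsum fun ξ => ?_
  rw [← ENNReal.tsum_mul_left]
  refine ENNReal.tsum_le_tsum fun η => ?_
  set F : ℝ × ℝ → ℝ≥0∞ := fun v => bracketPow (-(2 * p)) (v.1 + (ξ : ℝ) ^ 2) *
    (bracketPow (-(2 * p)) (v.2 + (η : ℝ) ^ 2) *
      bracketPow (-(2 * p)) (v.1 + v.2 + (((ξ + η - p₀.1 : ℤ) : ℝ) ^ 2 - p₀.2))) with hF
  have hFm : Measurable F := by fun_prop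
  calc ∫⁻ (x : ℝ) (y : ℝ), modKernel p w (p₀, (ξ, x), (η, y)) ^ 2
      = ∫⁻ (x : ℝ) (y : ℝ), w p₀.1 ξ η ^ 2 * F (x, y) := by
        refine lintegral_congr fun x => lintegral_congr fun y => ?_
        simp only [modKernel, mul_pow, modPow_sq, mul_neg, hF]
        simp only [modPow, modulation, freqThree, Prod.fst_add, Prod.fst_sub, Prod.snd_add,
          Prod.snd_sub]
        ring_nf
    _ = w p₀.1 ξ η ^ 2 * ∫⁻ (x : ℝ) (y : ℝ), F (x, y) := by
        rw [← lintegral_const_mul _ hFm.lintegral_prod_right']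
        exact lintegral_congr fun x => lintegral_const_mul _ (by fun_prop)
    _ ≤ w p₀.1 ξ η ^ 2 * (C * bracketPow (-r)
          ((ξ : ℝ) ^ 2 + (η : ℝ) ^ 2 - (((ξ + η - p₀.1 : ℤ) : ℝ) ^ 2 - p₀.2))) :=
        mul_le_mul_right (hC _ _ _) _
    _ = _ := by
        rw [mul_left_comm, ← bracketPow_neg_arg]
        simp only [modulation]
        push_cast
        ring_nf

theorem isBoundedKernel_modKernel {p r : ℝ} (hp : p < 1 / 2) (hr : 0 ≤ r) (hrp : r < 6 * p - 2)
    {w : ℤ → ℤ → ℤ → ℝ≥0∞} {C : ℝ≥0}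
    (hw : ∀ (κ : ℤ) (m : ℝ), ∑' (ξ : ℤ) (η : ℤ), w κ ξ η ^ 2 *
      bracketPow (-r) (2 * (ξ - κ : ℤ) * (η - κ : ℤ) - m) ≤ C) :
    IsBoundedKernel freqMeasure (modKernel p w) := by
  obtain ⟨D, hD⟩ := exists_lintegral_modKernel_sq_le hp hr hrp
  refine isBoundedKernel_of_lintegral_sq_le (measurable_modKernel p w) (C := D * C) fun p₀ => ?_
  rw [ENNReal.coe_mul]
  exact (hD w p₀).trans (mul_le_mul_right (hw _ _) _)

/-- The weight `⟨ξ⟩⁻ᵃ ⟨η⟩⁻ᵃ` restricted to nonresonant frequencies: `(κ - ξ)(κ - η) ≠ 0`. -/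
def nonresonantWeight (a : ℝ) (κ ξ η : ℤ) : ℝ≥0∞ :=
  if κ ≠ ξ ∧ κ ≠ η then bracketPow (-a) ξ * bracketPow (-a) η else 0

theorem nonresonantWeight_sq (a : ℝ) (κ ξ η : ℤ) :
    nonresonantWeight a κ ξ η ^ 2 = nonresonantWeight (2 * a) κ ξ η := by
  simp only [nonresonantWeight, ite_pow, mul_pow, bracketPow_sq, mul_neg,
    zero_pow two_ne_zero]

theorem exists_tsum_ite_ne_bracketPow_mul_le {p q r : ℝ} (hp : 1 < p) (hq : 0 ≤ q) (hr : 0 ≤ r)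
    (hqr : 1 < q + r) :
    ∃ C : ℝ≥0, ∀ (κ : ℤ) (m : ℝ), (∑' (ξ : ℤ) (η : ℤ), if κ ≠ ξ then bracketPow (-p) ξ *
      (bracketPow (-q) η * bracketPow (-r) (2 * (ξ - κ : ℤ) * (η - κ : ℤ) - m)) else 0) ≤ C := by
  obtain ⟨C, hC⟩ := exists_tsum_bracketPow_mul_linear_le hq hr hqr
  lift ∑' n : ℤ, bracketPow (-p) n to ℝ≥0 using (tsum_bracketPow_lt_top hp).ne with S hS
  refine ⟨S * C, fun κ m => ?_⟩
  rw [ENNReal.coe_mul, hS, ← ENNReal.tsum_mul_right]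
  refine ENNReal.tsum_le_tsum fun ξ => ?_
  by_cases h : κ ≠ ξ
  · simp only [if_pos h, ENNReal.tsum_mul_left]
    gcongr
    refine le_of_eq_of_le (tsum_congr fun η => congrArg _ (congrArg _ ?_))
      (hC (-2 * (ξ - κ : ℤ) * κ - m) (ξ - κ) (sub_ne_zero.2 h.symm))
    push_cast
    ring
  · simp only [if_neg h, tsum_zero, zero_le]

theorem exists_tsum_nonresonantWeight_le {a q r : ℝ} (hq : 0 ≤ q) (hr : 0 ≤ r) (hqa : q ≤ a)
    (ha : 1 < 2 * a - q) (hqr : 1 < q + r) :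
    ∃ C : ℝ≥0, ∀ (κ : ℤ) (m : ℝ), ∑' (ξ : ℤ) (η : ℤ), nonresonantWeight a κ ξ η *
      bracketPow (-r) (2 * (ξ - κ : ℤ) * (η - κ : ℤ) - m) ≤ C := by
  obtain ⟨C, hC⟩ := exists_tsum_ite_ne_bracketPow_mul_le ha hq hr hqr
  refine ⟨C + C, fun κ m => ?_⟩
  set g : ℤ → ℤ → ℝ≥0∞ := fun ξ η => if κ ≠ ξ then bracketPow (-(2 * a - q)) ξ *
    (bracketPow (-q) η * bracketPow (-r) (2 * (ξ - κ : ℤ) * (η - κ : ℤ) - m)) else 0 with hg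
  have hle (ξ η : ℤ) : nonresonantWeight a κ ξ η *
      bracketPow (-r) (2 * (ξ - κ : ℤ) * (η - κ : ℤ) - m) ≤ g ξ η + g η ξ := by
    by_cases h : κ ≠ ξ ∧ κ ≠ η
    · rw [nonresonantWeight, hg, if_pos h]
      simp only [if_pos h.1, if_pos h.2]
      rw [mul_right_comm 2 ((η - κ : ℤ) : ℝ)]
      refine (mul_le_mul_left (bracketPow_mul_le_add (p' := 2 * a - q) (q' := q) (by ring)
        (by linarith) hqa _ _) _).trans_eq ?_
      ring
    · rw [nonresonantWeight, if_neg h, zero_mul]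
      exact zero_le
  calc ∑' (ξ : ℤ) (η : ℤ), nonresonantWeight a κ ξ η *
        bracketPow (-r) (2 * (ξ - κ : ℤ) * (η - κ : ℤ) - m)
      ≤ ∑' (ξ : ℤ) (η : ℤ), (g ξ η + g η ξ) :=
        ENNReal.tsum_le_tsum fun ξ => ENNReal.tsum_le_tsum (hle ξ)
    _ = ∑' (ξ : ℤ) (η : ℤ), g ξ η + ∑' (ξ : ℤ) (η : ℤ), g ξ η := by
        simp_rw [ENNReal.tsum_add]
        rw [ENNReal.tsum_comm (f := fun ξ η => g η ξ)]
    _ ≤ C + C := add_le_add (hC κ m) (hC κ m)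

theorem exists_tsum_bracketPow_add_sub_mul_le {q r : ℝ} (hq : 1 < q) (hr : 1 / 2 < r) :
    ∃ C : ℝ≥0, ∀ (κ : ℤ) (m : ℝ), ∑' (ξ : ℤ) (η : ℤ), bracketPow (-q) (ξ + η - κ : ℤ) *
      bracketPow (-r) (2 * (ξ - κ : ℤ) * (η - κ : ℤ) - m) ≤ C := by
  obtain ⟨C, hC⟩ := exists_tsum_bracketPow_quadratic_le hr
  lift ∑' n : ℤ, bracketPow (-q) n to ℝ≥0 using (tsum_bracketPow_lt_top hq).ne with S hS
  refine ⟨S * C, fun κ m => ?_⟩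
  calc ∑' (ξ : ℤ) (η : ℤ), bracketPow (-q) (ξ + η - κ : ℤ) *
        bracketPow (-r) (2 * (ξ - κ : ℤ) * (η - κ : ℤ) - m)
      = ∑' (ξ : ℤ) (n : ℤ), bracketPow (-q) n *
          bracketPow (-r) (m + 2 * κ * n + 2 * (ξ : ℝ) ^ 2 + 2 * (-(n + κ) : ℤ) * ξ) := by
        refine tsum_congr fun ξ => ?_
        rw [← (Equiv.addRight (κ - ξ)).tsum_eq (fun η : ℤ => bracketPow (-q) (ξ + η - κ : ℤ) *
          bracketPow (-r) (2 * (ξ - κ : ℤ) * (η - κ : ℤ) - m))]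
        refine tsum_congr fun n => congrArg₂ _ (congrArg _ ?_) ?_
        · rw [Equiv.coe_addRight]
          push_cast
          ring
        · rw [← bracketPow_neg_arg, Equiv.coe_addRight]
          push_cast
          ring_nf
    _ = ∑' (n : ℤ) (ξ : ℤ), bracketPow (-q) n *
          bracketPow (-r) (m + 2 * κ * n + 2 * (ξ : ℝ) ^ 2 + 2 * (-(n + κ) : ℤ) * ξ) :=
        ENNReal.tsum_comm
    _ ≤ S * C := by
        rw [hS, ← ENNReal.tsum_mul_right]
        refine ENNReal.tsum_le_tsum fun n => ?_
        rw [ENNReal.tsum_mul_left]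
        exact mul_le_mul_right (hC _ _) _
    _ = _ := (ENNReal.coe_mul _ _).symm

/-- The kernel `⟨σ₀⟩⁻ᵖ ⟨σ₁⟩⁻ᵖ ⟨σ₂⟩⁻ᵖ ⟨σ₃⟩⁻ᵖ` for `p = 49 / 100`, which controls the contribution
without derivative loss. -/
def kernelUnit (z : (ℤ × ℝ) × (ℤ × ℝ) × (ℤ × ℝ)) : ℝ≥0∞ :=
  modPow (-(49 / 100)) z.1 * modPow (-(49 / 100)) (freqThree z) *
    (modPow (-(49 / 100)) z.2.1 * modPow (-(49 / 100)) z.2.2)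

/-- The kernel which controls the contribution of a dominant modulation of `p₀`. -/
def kernelZero : (ℤ × ℝ) × (ℤ × ℝ) × (ℤ × ℝ) → ℝ≥0∞ :=
  modKernel (49 / 100) (nonresonantWeight (1 / 2))

/-- The kernel which controls the contribution of a dominant modulation of `p₁`. -/
def kernelOne (z : (ℤ × ℝ) × (ℤ × ℝ) × (ℤ × ℝ)) : ℝ≥0∞ :=
  bracketPow (-(1 / 2)) z.2.1.1 * bracketPow (-(1 / 2)) z.2.2.1 *
    (modPow (-(49 / 100)) z.2.2 * (modPow (-(49 / 100)) z.1 * modPow (-(49 / 100)) (freqThree z)))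

/-- A majorant of `kernelOne` where the modulation of `p₂` exceeds its frequency. -/
def kernelOneHigh : (ℤ × ℝ) × (ℤ × ℝ) × (ℤ × ℝ) → ℝ≥0∞ :=
  modKernel (48 / 100) (fun κ ξ η => bracketPow (-(51 / 100)) (ξ + η - κ : ℤ)) ∘ swapPairs

/-- A majorant of `kernelOne` where the frequency of `p₂` exceeds its modulation. -/
def kernelOneLow (z : (ℤ × ℝ) × (ℤ × ℝ) × (ℤ × ℝ)) : ℝ≥0∞ :=
  modPow (-(49 / 100)) z.1 * modPow (-(49 / 100)) (freqThree z) *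
    (bracketPow (-(1 / 2)) z.2.1.1 * bracketPow (-(48 / 100)) z.2.2.1 *
      modPow (-(51 / 100)) z.2.2)

theorem exists_lintegral_modPow_pair_sq_le :
    ∃ C : ℝ≥0, ∀ s : ℤ × ℝ,
      ∫⁻ k, (modPow (-(49 / 100)) k * modPow (-(49 / 100)) (s - k)) ^ 2 ∂freqMeasure ≤ C := by
  simpa only [mul_pow, modPow_sq, mul_neg] using
    exists_lintegral_modPow_mul_sub_le (p := 2 * (49 / 100)) (by norm_num)

theorem isBoundedKernel_kernelUnit : IsBoundedKernel freqMeasure kernelUnit := by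
  obtain ⟨C, hC⟩ := exists_lintegral_modPow_pair_sq_le
  exact isBoundedKernel_mul_of_lintegral_sq_le
    (k := fun q => modPow (-(49 / 100)) q.1 * modPow (-(49 / 100)) q.2)
    (l := fun q => modPow (-(49 / 100)) q.1 * modPow (-(49 / 100)) q.2)
    (by fun_prop) (by fun_prop) hC hC

theorem isBoundedKernel_kernelZero : IsBoundedKernel freqMeasure kernelZero := by
  obtain ⟨C, hC⟩ := exists_tsum_nonresonantWeight_le (a := 2 * (1 / 2)) (q := 1 / 5) (r := 9 / 10)
    (by norm_num) (by norm_num) (by norm_num) (by norm_num) (by norm_num)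
  refine isBoundedKernel_modKernel (r := 9 / 10) (C := C) (by norm_num) (by norm_num)
    (by norm_num) ?_
  simpa only [nonresonantWeight_sq] using hC

theorem isBoundedKernel_kernelOneHigh : IsBoundedKernel freqMeasure kernelOneHigh := by
  obtain ⟨C, hC⟩ := exists_tsum_bracketPow_add_sub_mul_le (q := 2 * (51 / 100)) (r := 3 / 4)
    (by norm_num) (by norm_num)
  refine (isBoundedKernel_modKernel (r := 3 / 4) (C := C) (by norm_num) (by norm_num)
    (by norm_num) ?_).swapPairs
  simpa only [bracketPow_sq, mul_neg] using hC

theorem isBoundedKernel_kernelOneLow : IsBoundedKernel freqMeasure kernelOneLow := by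
  obtain ⟨C, hC⟩ := exists_lintegral_modPow_pair_sq_le
  obtain ⟨D, hD⟩ := exists_lintegral_bracketPow_mul_modPow_sub_le (p := 2 * (1 / 2))
    (q := 2 * (48 / 100)) (r := 2 * (51 / 100)) (by norm_num) (by norm_num) (by norm_num)
    (by norm_num)
  refine isBoundedKernel_mul_of_lintegral_sq_le
    (k := fun q => modPow (-(49 / 100)) q.1 * modPow (-(49 / 100)) q.2)
    (l := fun q => bracketPow (-(1 / 2)) q.1.1 * bracketPow (-(48 / 100)) q.2.1 *
      modPow (-(51 / 100)) q.2)
    (by fun_prop) (by fun_prop) (D := D) hC fun s => ?_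
  simpa only [mul_pow, modPow_sq, bracketPow_sq, mul_neg] using hD s

theorem bracketPow_mul_modPow_le (k : ℤ × ℝ) :
    bracketPow (-(1 / 2)) k.1 * modPow (-(49 / 100)) k ≤
      bracketPow (-(51 / 100)) k.1 * modPow (-(48 / 100)) k +
        bracketPow (-(48 / 100)) k.1 * modPow (-(51 / 100)) k :=
  bracketPow_mul_le_add (by norm_num) (by norm_num) (by norm_num) _ _

theorem kernelOne_le (z : (ℤ × ℝ) × (ℤ × ℝ) × (ℤ × ℝ)) :
    kernelOne z ≤ kernelOneHigh z + kernelOneLow z := by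
  have hfreq : z.1.1 + (freqThree z).1 - z.2.1.1 = z.2.2.1 :=
    congrArg Prod.fst (freqThree_swapPairs z)
  have hmono (k : ℤ × ℝ) : modPow (-(49 / 100)) k ≤ modPow (-(48 / 100)) k :=
    bracketPow_mono (by norm_num) _
  calc kernelOne z
      = bracketPow (-(1 / 2)) z.2.1.1 * (modPow (-(49 / 100)) z.1 *
          modPow (-(49 / 100)) (freqThree z)) *
            (bracketPow (-(1 / 2)) z.2.2.1 * modPow (-(49 / 100)) z.2.2) := by
        rw [kernelOne]
        ring
    _ ≤ bracketPow (-(1 / 2)) z.2.1.1 * (modPow (-(49 / 100)) z.1 *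
          modPow (-(49 / 100)) (freqThree z)) *
            (bracketPow (-(51 / 100)) z.2.2.1 * modPow (-(48 / 100)) z.2.2) + kernelOneLow z := by
        refine (mul_le_mul_right (bracketPow_mul_modPow_le z.2.2) _).trans_eq ?_
        rw [kernelOneLow]
        ring
    _ ≤ 1 * (modPow (-(48 / 100)) z.1 * modPow (-(48 / 100)) (freqThree z)) *
            (bracketPow (-(51 / 100)) z.2.2.1 * modPow (-(48 / 100)) z.2.2) + kernelOneLow z := by
        gcongr
        · exact bracketPow_neg_le_one (by norm_num) _
        · exact hmono _
        · exact hmono _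
    _ = kernelOneHigh z + kernelOneLow z := by
        simp only [kernelOneHigh, Function.comp_apply, modKernel, freqThree_swapPairs]
        simp only [swapPairs, hfreq]
        ring

theorem isBoundedKernel_kernelOne : IsBoundedKernel freqMeasure kernelOne :=
  (isBoundedKernel_kernelOneHigh.add isBoundedKernel_kernelOneLow).mono
    (by unfold kernelOne; fun_prop) kernelOne_le

/-! ### The multiplier -/

theorem bracket_mul_abs_le (ξ₀ ξ₁ ξ₂ : ℤ) :
    bracket ξ₀ * |((ξ₁ + ξ₂ - ξ₀ : ℤ) : ℝ)| ≤
      2 * (bracket ξ₁ * bracket ξ₂ + |((ξ₀ : ℝ) - ξ₁) * (ξ₀ - ξ₂)|) := by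
  push_cast
  have hb₁ := abs_le_bracket ξ₁
  have hb₂ := abs_le_bracket ξ₂
  rcases eq_or_ne ξ₀ 0 with rfl | h
  · have hbracket : bracket ((0 : ℤ) : ℝ) = 1 := by simp [bracket]
    have htriangle : |(ξ₁ : ℝ) + ξ₂ - (0 : ℤ)| ≤ |(ξ₁ : ℝ)| + |(ξ₂ : ℝ)| := by
      simpa using abs_add_le (ξ₁ : ℝ) ξ₂
    rw [hbracket]
    nlinarith [one_le_bracket ξ₁, one_le_bracket ξ₂,
      abs_nonneg ((((0 : ℤ) : ℝ) - ξ₁) * ((0 : ℤ) - ξ₂))]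
  · have hone : (1 : ℝ) ≤ |(ξ₀ : ℝ)| := by exact_mod_cast Int.one_le_abs h
    calc bracket ξ₀ * |(ξ₁ : ℝ) + ξ₂ - ξ₀|
        ≤ 2 * |(ξ₀ : ℝ)| * |(ξ₁ : ℝ) + ξ₂ - ξ₀| := by
          gcongr
          linarith [bracket_le_one_add_abs ξ₀]
      _ = 2 * |(ξ₁ : ℝ) * ξ₂ - ((ξ₀ : ℝ) - ξ₁) * (ξ₀ - ξ₂)| := by
          rw [mul_assoc, ← abs_mul]
          ring_nf
      _ ≤ 2 * (|(ξ₁ : ℝ)| * |(ξ₂ : ℝ)| + |((ξ₀ : ℝ) - ξ₁) * (ξ₀ - ξ₂)|) := by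
          rw [← abs_mul]
          gcongr
          exact abs_sub _ _
      _ ≤ _ := by
          have := (bracket_pos ξ₁).le
          gcongr

/-- The resonance function `(ξ₀ - ξ₁)(ξ₀ - ξ₂)`. -/
def resonance (z : (ℤ × ℝ) × (ℤ × ℝ) × (ℤ × ℝ)) : ℝ :=
  ((z.1.1 : ℝ) - z.2.1.1) * (z.1.1 - z.2.2.1)

/-- The sum of the `p`-th powers of the brackets of the four modulations. -/
def modSum (p : ℝ) (z : (ℤ × ℝ) × (ℤ × ℝ) × (ℤ × ℝ)) : ℝ≥0∞ :=
  modPow p z.1 + modPow p z.2.1 + modPow p z.2.2 + modPow p (freqThree z)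

theorem two_mul_resonance (z : (ℤ × ℝ) × (ℤ × ℝ) × (ℤ × ℝ)) :
    2 * resonance z = modulation z.1 - modulation z.2.1 - modulation z.2.2 +
      modulation (freqThree z) := by
  simp only [resonance, modulation, freqThree, Prod.fst_add, Prod.fst_sub, Prod.snd_add,
    Prod.snd_sub]
  push_cast
  ring

theorem two_mul_abs_resonance_le (z : (ℤ × ℝ) × (ℤ × ℝ) × (ℤ × ℝ)) :
    2 * ENNReal.ofReal |resonance z| ≤ modSum 1 z := by
  have hb (k : ℤ × ℝ) : 0 ≤ bracket (modulation k) := (bracket_pos _).le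
  have habs : 2 * |resonance z| ≤ bracket (modulation z.1) + bracket (modulation z.2.1) +
      bracket (modulation z.2.2) + bracket (modulation (freqThree z)) := by
    rw [← abs_two (α := ℝ), ← abs_mul, two_mul_resonance]
    refine (abs_add_le _ _).trans (add_le_add ((abs_sub _ _).trans (add_le_add
      ((abs_sub _ _).trans (add_le_add ?_ ?_)) ?_)) ?_) <;> exact abs_le_bracket _
  calc 2 * ENNReal.ofReal |resonance z| = ENNReal.ofReal (2 * |resonance z|) := by
        rw [ENNReal.ofReal_mul zero_le_two, ENNReal.ofReal_ofNat]
    _ ≤ _ := ENNReal.ofReal_le_ofReal habs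
    _ = modSum 1 z := by
        simp only [modSum, modPow, bracketPow_one]
        rw [ENNReal.ofReal_add (by linarith [hb z.1, hb z.2.1, hb z.2.2]) (hb _),
          ENNReal.ofReal_add (by linarith [hb z.1, hb z.2.1]) (hb _),
          ENNReal.ofReal_add (hb _) (hb _)]

/-- The ratio `⟨ξ₀⟩^½ |ξ₃| ⟨ξ₁⟩^-½ ⟨ξ₂⟩^-½ ⟨ξ₃⟩^-½` of Sobolev weights, including the derivative on
the third factor. -/
def multiplier (z : (ℤ × ℝ) × (ℤ × ℝ) × (ℤ × ℝ)) : ℝ≥0∞ :=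
  bracketPow (1 / 2) z.1.1 * ENNReal.ofReal |((freqThree z).1 : ℝ)| *
    (bracketPow (-(1 / 2)) z.2.1.1 * bracketPow (-(1 / 2)) z.2.2.1 *
      bracketPow (-(1 / 2)) (freqThree z).1)

theorem abs_resonance_mul_eq (z : (ℤ × ℝ) × (ℤ × ℝ) × (ℤ × ℝ)) :
    ENNReal.ofReal |resonance z| * (bracketPow (-1) z.2.1.1 * bracketPow (-1) z.2.2.1) =
      ENNReal.ofReal |resonance z| * nonresonantWeight 1 z.1.1 z.2.1.1 z.2.2.1 := by
  by_cases h : z.1.1 ≠ z.2.1.1 ∧ z.1.1 ≠ z.2.2.1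
  · rw [nonresonantWeight, if_pos h]
  · have hzero : resonance z = 0 := by
      rw [not_and_or, not_not, not_not] at h
      rcases h with h | h <;> simp [resonance, h]
    rw [hzero, abs_zero, ENNReal.ofReal_zero, zero_mul, zero_mul]

theorem multiplier_sq_le (z : (ℤ × ℝ) × (ℤ × ℝ) × (ℤ × ℝ)) :
    multiplier z ^ 2 ≤ 2 + nonresonantWeight 1 z.1.1 z.2.1.1 z.2.2.1 * modSum 1 z := by
  set ξ₃ : ℤ := (freqThree z).1 with hξ₃
  have hfreq : bracketPow 1 z.1.1 * ENNReal.ofReal |(ξ₃ : ℝ)| ≤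
      2 * (bracketPow 1 z.2.1.1 * bracketPow 1 z.2.2.1 + ENNReal.ofReal |resonance z|) := by
    have h := ENNReal.ofReal_le_ofReal (bracket_mul_abs_le z.1.1 z.2.1.1 z.2.2.1)
    rwa [ENNReal.ofReal_mul (bracket_pos _).le, ENNReal.ofReal_mul zero_le_two,
      ENNReal.ofReal_add (mul_nonneg (bracket_pos _).le (bracket_pos _).le) (abs_nonneg _),
      ENNReal.ofReal_mul (bracket_pos _).le, ENNReal.ofReal_ofNat, ← bracketPow_one,
      ← bracketPow_one, ← bracketPow_one] at h
  have hthree : ENNReal.ofReal |(ξ₃ : ℝ)| * bracketPow (-1) ξ₃ ≤ 1 := by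
    rw [← bracketPow_mul_bracketPow_neg 1 ξ₃, bracketPow_one]
    gcongr
    exact abs_le_bracket _
  have hunit : bracketPow 1 z.2.1.1 * bracketPow 1 z.2.2.1 *
      (bracketPow (-1) z.2.1.1 * bracketPow (-1) z.2.2.1) = 1 := by
    rw [mul_mul_mul_comm, bracketPow_mul_bracketPow_neg, bracketPow_mul_bracketPow_neg, mul_one]
  calc multiplier z ^ 2
      = bracketPow 1 z.1.1 * ENNReal.ofReal |(ξ₃ : ℝ)| *
          (ENNReal.ofReal |(ξ₃ : ℝ)| * bracketPow (-1) ξ₃) *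
            (bracketPow (-1) z.2.1.1 * bracketPow (-1) z.2.2.1) := by
        simp only [multiplier, mul_pow, bracketPow_sq, mul_neg, ← hξ₃]
        rw [mul_one_div_cancel two_ne_zero]
        ring
    _ ≤ 2 * (bracketPow 1 z.2.1.1 * bracketPow 1 z.2.2.1 + ENNReal.ofReal |resonance z|) * 1 *
          (bracketPow (-1) z.2.1.1 * bracketPow (-1) z.2.2.1) := by gcongr
    _ = 2 + 2 * (ENNReal.ofReal |resonance z| *
          (bracketPow (-1) z.2.1.1 * bracketPow (-1) z.2.2.1)) := by
        rw [mul_one, mul_assoc, add_mul, hunit, mul_add, mul_one]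
    _ = 2 + nonresonantWeight 1 z.1.1 z.2.1.1 z.2.2.1 * (2 * ENNReal.ofReal |resonance z|) := by
        rw [abs_resonance_mul_eq]
        ring
    _ ≤ _ := by
        gcongr
        exact two_mul_abs_resonance_le z

theorem sq_add_sq_le_add_sq (a b : ℝ≥0∞) : a ^ 2 + b ^ 2 ≤ (a + b) ^ 2 := by
  rw [add_sq, add_right_comm]
  exact le_self_add

theorem modSum_two_mul_le (p : ℝ) (z : (ℤ × ℝ) × (ℤ × ℝ) × (ℤ × ℝ)) :
    modSum (2 * p) z ≤ modSum p z ^ 2 := by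
  simp only [modSum, ← modPow_sq]
  refine le_trans ?_ (sq_add_sq_le_add_sq _ _)
  gcongr
  refine le_trans ?_ (sq_add_sq_le_add_sq _ _)
  gcongr
  exact sq_add_sq_le_add_sq _ _

theorem multiplier_le (z : (ℤ × ℝ) × (ℤ × ℝ) × (ℤ × ℝ)) :
    multiplier z ≤ 2 + nonresonantWeight (1 / 2) z.1.1 z.2.1.1 z.2.2.1 * modSum (1 / 2) z := by
  refine (ENNReal.pow_le_pow_left_iff two_ne_zero).1 ?_
  calc multiplier z ^ 2
      ≤ 2 + nonresonantWeight 1 z.1.1 z.2.1.1 z.2.2.1 * modSum 1 z := multiplier_sq_le z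
    _ = 2 + nonresonantWeight (1 / 2) z.1.1 z.2.1.1 z.2.2.1 ^ 2 * modSum (2 * (1 / 2)) z := by
        rw [nonresonantWeight_sq, mul_one_div_cancel two_ne_zero]
    _ ≤ 2 ^ 2 + (nonresonantWeight (1 / 2) z.1.1 z.2.1.1 z.2.2.1 * modSum (1 / 2) z) ^ 2 := by
        rw [mul_pow]
        gcongr
        · norm_num
        · exact modSum_two_mul_le _ _
    _ ≤ _ := sq_add_sq_le_add_sq _ _

/-! ### The weighted quadrilinear estimate -/

/-- The kernel of the trilinear estimate, written by duality as a quadrilinear form. -/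
def fullKernel (z : (ℤ × ℝ) × (ℤ × ℝ) × (ℤ × ℝ)) : ℝ≥0∞ :=
  multiplier z * (modPow (-(1 / 2)) z.1 * modPow (-(1 / 2)) z.2.1 * modPow (-(1 / 2)) z.2.2 *
    modPow (-(1 / 2)) (freqThree z))

/-- The part of the majorant of `fullKernel` in which the modulation of `p₁` is not dominant, so
that a power of it is left over. -/
def kernelMain (z : (ℤ × ℝ) × (ℤ × ℝ) × (ℤ × ℝ)) : ℝ≥0∞ :=
  kernelUnit z + kernelUnit z + kernelZero z + kernelOne (swapOneTwo z) +
    kernelZero (swapZeroThree z)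

theorem isBoundedKernel_kernelMain : IsBoundedKernel freqMeasure kernelMain :=
  (((isBoundedKernel_kernelUnit.add isBoundedKernel_kernelUnit).add
    isBoundedKernel_kernelZero).add isBoundedKernel_kernelOne.swapOneTwo).add
      isBoundedKernel_kernelZero.swapZeroThree

theorem nonresonantWeight_le (a : ℝ) (κ ξ η : ℤ) :
    nonresonantWeight a κ ξ η ≤ bracketPow (-a) ξ * bracketPow (-a) η := by
  unfold nonresonantWeight
  split_ifs
  exacts [le_rfl, zero_le]

theorem nonresonantWeight_reflect (a : ℝ) (κ ξ η : ℤ) :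
    nonresonantWeight a (ξ + η - κ) ξ η = nonresonantWeight a κ ξ η :=
  if_congr (by omega) rfl rfl

theorem modSum_mul (p : ℝ) (z : (ℤ × ℝ) × (ℤ × ℝ) × (ℤ × ℝ)) :
    modSum p z * (modPow (-p) z.1 * modPow (-p) z.2.1 * modPow (-p) z.2.2 *
        modPow (-p) (freqThree z)) =
      modPow (-p) z.2.1 * modPow (-p) z.2.2 * modPow (-p) (freqThree z) +
        modPow (-p) z.1 * modPow (-p) z.2.2 * modPow (-p) (freqThree z) +
        modPow (-p) z.1 * modPow (-p) z.2.1 * modPow (-p) (freqThree z) +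
        modPow (-p) z.1 * modPow (-p) z.2.1 * modPow (-p) z.2.2 := by
  have hinv (k : ℤ × ℝ) : modPow p k * modPow (-p) k = 1 := bracketPow_mul_bracketPow_neg _ _
  calc _ = (modPow p z.1 * modPow (-p) z.1) *
            (modPow (-p) z.2.1 * modPow (-p) z.2.2 * modPow (-p) (freqThree z)) +
          (modPow p z.2.1 * modPow (-p) z.2.1) *
            (modPow (-p) z.1 * modPow (-p) z.2.2 * modPow (-p) (freqThree z)) +
          (modPow p z.2.2 * modPow (-p) z.2.2) *
            (modPow (-p) z.1 * modPow (-p) z.2.1 * modPow (-p) (freqThree z)) +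
          (modPow p (freqThree z) * modPow (-p) (freqThree z)) *
            (modPow (-p) z.1 * modPow (-p) z.2.1 * modPow (-p) z.2.2) := by
        rw [modSum]
        ring
    _ = _ := by simp only [hinv, one_mul]

theorem fullKernel_le (z : (ℤ × ℝ) × (ℤ × ℝ) × (ℤ × ℝ)) :
    fullKernel z ≤ modPow (-(1 / 100)) z.2.1 * kernelMain z +
      modPow (-(1 / 100)) z.2.2 * kernelOne z := by
  set h := modPow (-(1 / 2)) with hh
  set b := modPow (-(49 / 100)) with hb
  set e := modPow (-(1 / 100)) with he
  set W := nonresonantWeight (1 / 2) z.1.1 z.2.1.1 z.2.2.1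
  set V := bracketPow (-(1 / 2)) z.2.1.1 * bracketPow (-(1 / 2)) z.2.2.1
  have hmul : multiplier z ≤ 2 + W * modSum (1 / 2) z := multiplier_le z
  have hWV : W ≤ V := nonresonantWeight_le _ _ _ _
  have hreflect : nonresonantWeight (1 / 2) (freqThree z).1 z.2.1.1 z.2.2.1 = W :=
    nonresonantWeight_reflect _ _ _ _
  have hle (k : ℤ × ℝ) : h k ≤ b k := bracketPow_mono (by norm_num) _
  have hsplit (k : ℤ × ℝ) : h k ≤ e k * b k := by
    rw [hh, he, hb, modPow, modPow, modPow, ← bracketPow_add]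
    norm_num
  calc fullKernel z
      ≤ 2 * (h z.1 * h z.2.1 * h z.2.2 * h (freqThree z)) +
          (W * (h z.2.1 * h z.2.2 * h (freqThree z)) + W * (h z.1 * h z.2.2 * h (freqThree z)) +
            W * (h z.1 * h z.2.1 * h (freqThree z)) + W * (h z.1 * h z.2.1 * h z.2.2)) := by
        refine (mul_le_mul_left hmul _).trans_eq ?_
        rw [add_mul, mul_assoc W, modSum_mul, mul_add, mul_add, mul_add]
    _ ≤ 2 * (b z.1 * (e z.2.1 * b z.2.1) * b z.2.2 * b (freqThree z)) +
          (W * ((e z.2.1 * b z.2.1) * b z.2.2 * b (freqThree z)) +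
            V * (b z.1 * (e z.2.2 * b z.2.2) * b (freqThree z)) +
            V * (b z.1 * (e z.2.1 * b z.2.1) * b (freqThree z)) +
            W * (b z.1 * (e z.2.1 * b z.2.1) * b z.2.2)) := by
        gcongr <;> first | exact hle _ | exact hsplit _
    _ = _ := by
        simp only [kernelMain, kernelUnit, kernelZero, kernelOne, modKernel, freqThree_swapOneTwo,
          freqThree_swapZeroThree]
        simp only [swapOneTwo, swapZeroThree, hreflect]
        ring

theorem exists_quadForm_fullKernel_sq_le :
    ∃ C : ℝ≥0, ∀ (θ : ℝ≥0∞) (f₀ f₁ f₂ f₃ : ℤ × ℝ → ℝ≥0∞), Measurable f₀ → Measurable f₁ →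
      Measurable f₂ → Measurable f₃ →
      sqNorm freqMeasure (fun k => modPow (-(1 / 100)) k * f₁ k) ≤ θ * sqNorm freqMeasure f₁ →
      sqNorm freqMeasure (fun k => modPow (-(1 / 100)) k * f₂ k) ≤ θ * sqNorm freqMeasure f₂ →
      quadForm freqMeasure f₀ f₁ f₂ f₃ fullKernel ^ 2 ≤ C * θ * (sqNorm freqMeasure f₀ *
        (sqNorm freqMeasure f₁ * sqNorm freqMeasure f₂ * sqNorm freqMeasure f₃)) := by
  obtain ⟨C, hC⟩ := isBoundedKernel_kernelMain.bound
  obtain ⟨D, hD⟩ := isBoundedKernel_kernelOne.bound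
  refine ⟨2 * (C + D), fun θ f₀ f₁ f₂ f₃ h₀ h₁ h₂ h₃ hθ₁ hθ₂ => ?_⟩
  set g₁ : ℤ × ℝ → ℝ≥0∞ := fun k => modPow (-(1 / 100)) k * f₁ k with hg₁
  set g₂ : ℤ × ℝ → ℝ≥0∞ := fun k => modPow (-(1 / 100)) k * f₂ k with hg₂
  have hm := isBoundedKernel_kernelMain.measurable
  have hsum : quadForm freqMeasure f₀ f₁ f₂ f₃ fullKernel ≤
      quadForm freqMeasure f₀ g₁ f₂ f₃ kernelMain + quadForm freqMeasure f₀ f₁ g₂ f₃ kernelOne := by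
    rw [quadForm, quadForm, quadForm, ← lintegral_add_left (by fun_prop)]
    refine lintegral_mono fun z => (mul_le_mul_right (fullKernel_le z) _).trans_eq ?_
    rw [hg₁, hg₂]
    ring
  calc _ ≤ 2 * (quadForm freqMeasure f₀ g₁ f₂ f₃ kernelMain ^ 2 +
          quadForm freqMeasure f₀ f₁ g₂ f₃ kernelOne ^ 2) := by
        refine le_trans ?_ (add_sq_le_two_mul_sq_add_sq _ _)
        gcongr
    _ ≤ 2 * (C * (sqNorm freqMeasure f₀ *
            (θ * sqNorm freqMeasure f₁ * sqNorm freqMeasure f₂ * sqNorm freqMeasure f₃)) +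
          D * (sqNorm freqMeasure f₀ *
            (sqNorm freqMeasure f₁ * (θ * sqNorm freqMeasure f₂) * sqNorm freqMeasure f₃))) := by
        have hmain := hC f₀ g₁ f₂ f₃ h₀ (by fun_prop) h₂ h₃
        have hone := hD f₀ f₁ g₂ f₃ h₀ h₁ (by fun_prop) h₃
        gcongr
        · exact hmain.trans (by gcongr)
        · exact hone.trans (by gcongr)
    _ = _ := by
        push_cast
        ring

/-! ### The Fourier transform in time -/

/-- The normalizing constant `(2π)^{-1/2}` of the Fourier transforms. -/
def fourierConst : ℝ := (2 * Real.pi) ^ (-(1 / 2) : ℝ)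

theorem fourierConst_pos : 0 < fourierConst := by
  unfold fourierConst
  positivity

theorem fourierConst_mul_self : fourierConst * fourierConst = (2 * Real.pi)⁻¹ := by
  unfold fourierConst
  rw [← Real.rpow_add (by positivity), ← Real.rpow_neg_one]
  norm_num only

theorem enorm_fourierConst_sq : ‖(fourierConst : ℂ)‖ₑ ^ 2 = ENNReal.ofReal (2 * Real.pi)⁻¹ := by
  rw [← ofReal_norm, Complex.norm_real, Real.norm_of_nonneg fourierConst_pos.le,
    ← ENNReal.ofReal_pow fourierConst_pos.le, sq, fourierConst_mul_self]

theorem fourierT_eq_fourier (g : ℝ → ℂ) (τ : ℝ) :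
    fourierT g τ = fourierConst * 𝓕 g (τ / (2 * Real.pi)) := by
  unfold fourierT
  rw [Real.fourier_real_eq_integral_exp_smul]
  congr 1
  refine integral_congr_ae (.of_forall fun t => ?_)
  have hpi : (Real.pi : ℂ) ≠ 0 := by exact_mod_cast Real.pi_ne_zero
  simp only [smul_eq_mul]
  congr 2
  push_cast
  field_simp

theorem enorm_fourierT_le (g : ℝ → ℂ) (τ : ℝ) :
    ‖fourierT g τ‖ₑ ≤ ‖(fourierConst : ℂ)‖ₑ * ∫⁻ t, ‖g t‖ₑ := by
  unfold fourierT
  rw [enorm_mul]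
  refine mul_le_mul_right ((enorm_integral_le_lintegral_enorm _).trans_eq ?_) _
  refine lintegral_congr fun t => ?_
  rw [enorm_mul, ← ofReal_norm, Complex.norm_exp]
  simp

theorem fourierT_deriv {g : ℝ → ℂ} (hg : Integrable g) (hd : Differentiable ℝ g)
    (hg' : Integrable (deriv g)) (τ : ℝ) : fourierT (deriv g) τ = Complex.I * τ * fourierT g τ := by
  have hpi : (Real.pi : ℂ) ≠ 0 := by exact_mod_cast Real.pi_ne_zero
  rw [fourierT_eq_fourier, fourierT_eq_fourier, Real.fourier_deriv hg hd hg']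
  simp only [smul_eq_mul]
  push_cast
  field_simp

theorem continuous_fourierT (g : 𝓢(ℝ, ℂ)) : Continuous (fourierT g) := by
  rw [funext (fourierT_eq_fourier g), ← SchwartzMap.fourier_coe]
  fun_prop

theorem fourierT_inversion (g : 𝓢(ℝ, ℂ)) (t : ℝ) :
    g t = fourierConst * ∫ τ : ℝ, Complex.exp (Complex.I * t * τ) * fourierT g τ := by
  have hinv : 𝓕⁻ (𝓕 (g : ℝ → ℂ)) t = g t := by
    rw [← SchwartzMap.fourier_coe, ← SchwartzMap.fourierInv_coe,
      FourierTransform.fourierInv_fourier_eq]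
  have hrescale : ∀ τ : ℝ, Complex.exp (Complex.I * t * τ) * fourierT g τ = fourierConst *
      (Complex.exp (((2 * Real.pi * inner ℝ (τ / (2 * Real.pi)) t : ℝ) : ℂ) * Complex.I) •
        𝓕 (g : ℝ → ℂ) (τ / (2 * Real.pi))) := fun τ => by
    have hpi : (Real.pi : ℂ) ≠ 0 := by exact_mod_cast Real.pi_ne_zero
    rw [fourierT_eq_fourier, smul_eq_mul, mul_left_comm]
    congr 3
    simp only [RCLike.inner_apply, conj_trivial]
    push_cast
    field_simp
  simp_rw [hrescale]
  rw [integral_const_mul, Measure.integral_comp_div (fun w : ℝ => Complex.exp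
    (((2 * Real.pi * inner ℝ w t : ℝ) : ℂ) * Complex.I) • 𝓕 (g : ℝ → ℂ) w), ← Real.fourierInv_eq',
    hinv, abs_of_pos Real.two_pi_pos, ← mul_assoc, ← Complex.ofReal_mul, fourierConst_mul_self,
    Complex.real_smul, ← mul_assoc, ← Complex.ofReal_mul, inv_mul_cancel₀ Real.two_pi_pos.ne',
    Complex.ofReal_one, one_mul]

theorem lintegral_enorm_sq_eq_ofReal {g : ℝ → ℂ} (hg : Integrable fun t => ‖g t‖ ^ 2) :
    ∫⁻ t, ‖g t‖ₑ ^ 2 = ENNReal.ofReal (∫ t, ‖g t‖ ^ 2) := by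
  rw [ofReal_integral_eq_lintegral_ofReal hg (.of_forall fun t => by positivity)]
  simp_rw [ENNReal.ofReal_pow (norm_nonneg _), ofReal_norm]

theorem lintegral_enorm_sq_fourierT (g : 𝓢(ℝ, ℂ)) :
    ∫⁻ τ, ‖fourierT g τ‖ₑ ^ 2 = ∫⁻ t, ‖g t‖ₑ ^ 2 := by
  have hsq (h : 𝓢(ℝ, ℂ)) : Integrable fun t => ‖h t‖ ^ 2 :=
    (h.memLp 2).integrable_norm_pow two_ne_zero
  have hrescale : (fun τ : ℝ => ‖fourierT g τ‖ ^ 2) =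
      fun τ => (2 * Real.pi)⁻¹ * ‖𝓕 g (τ / (2 * Real.pi))‖ ^ 2 := by
    ext τ
    rw [fourierT_eq_fourier, norm_mul, Complex.norm_real, mul_pow, sq ‖fourierConst‖,
      Real.norm_of_nonneg fourierConst_pos.le, fourierConst_mul_self, SchwartzMap.fourier_coe]
  have hint : Integrable fun τ : ℝ => ‖fourierT g τ‖ ^ 2 := by
    rw [hrescale]
    exact ((hsq (𝓕 g)).comp_div Real.two_pi_pos.ne').const_mul _
  rw [lintegral_enorm_sq_eq_ofReal hint, lintegral_enorm_sq_eq_ofReal (hsq g), hrescale,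
    integral_const_mul, Measure.integral_comp_div (fun w => ‖𝓕 g w‖ ^ 2),
    SchwartzMap.integral_norm_sq_fourier, abs_of_pos Real.two_pi_pos, smul_eq_mul, ← mul_assoc,
    inv_mul_cancel₀ Real.two_pi_pos.ne', one_mul]

theorem sq_lintegral_enorm_le_of_support {g : ℝ → ℂ} {T : ℝ} (hm : AEStronglyMeasurable g)
    (hg : ∀ t, T < |t| → g t = 0) :
    (∫⁻ t, ‖g t‖ₑ) ^ 2 ≤ ENNReal.ofReal (2 * T) * ∫⁻ t, ‖g t‖ₑ ^ 2 := by
  set χ : ℝ → ℝ≥0∞ := (Set.Icc (-T) T).indicator 1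
  have hχm : Measurable χ := measurable_one.indicator measurableSet_Icc
  have hmul : ∀ t, ‖g t‖ₑ = χ t * ‖g t‖ₑ := fun t => by
    by_cases ht : t ∈ Set.Icc (-T) T
    · simp [χ, ht]
    · rw [hg t (not_le.1 fun h => ht (abs_le.1 h)), enorm_zero, mul_zero]
  have hχ : ∫⁻ t, χ t ^ 2 = ENNReal.ofReal (2 * T) := by
    have hsq : ∀ t, χ t ^ 2 = χ t := fun t => by
      by_cases ht : t ∈ Set.Icc (-T) T <;> simp [χ, ht]
    simp_rw [hsq]
    rw [lintegral_indicator_one measurableSet_Icc, Real.volume_Icc]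
    ring_nf
  calc (∫⁻ t, ‖g t‖ₑ) ^ 2 = (∫⁻ t, χ t * ‖g t‖ₑ) ^ 2 := by rw [← lintegral_congr hmul]
    _ ≤ (∫⁻ t, χ t ^ 2) * ∫⁻ t, ‖g t‖ₑ ^ 2 :=
        sq_lintegral_mul_le _ hχm.aemeasurable hm.enorm
    _ = _ := by rw [hχ]

theorem enorm_sq_fourierT_le_of_support {g : ℝ → ℂ} {T : ℝ} (hm : AEStronglyMeasurable g)
    (hg : ∀ t, T < |t| → g t = 0) (τ : ℝ) :
    ‖fourierT g τ‖ₑ ^ 2 ≤ ENNReal.ofReal (T / Real.pi) * ∫⁻ t, ‖g t‖ₑ ^ 2 := by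
  calc ‖fourierT g τ‖ₑ ^ 2 ≤ (‖(fourierConst : ℂ)‖ₑ * ∫⁻ t, ‖g t‖ₑ) ^ 2 :=
        pow_le_pow_left' (enorm_fourierT_le g τ) 2
    _ ≤ ENNReal.ofReal (2 * Real.pi)⁻¹ * (ENNReal.ofReal (2 * T) * ∫⁻ t, ‖g t‖ₑ ^ 2) := by
        rw [mul_pow, enorm_fourierConst_sq]
        gcongr
        exact sq_lintegral_enorm_le_of_support hm hg
    _ = _ := by
        rw [← mul_assoc, ← ENNReal.ofReal_mul (by positivity)]
        congr 2
        field_simp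

/-! ### The gain from a short time support -/

theorem lintegral_le_add_lintegral_bracketPow_mul {F : ℝ → ℝ≥0∞} {M : ℝ≥0∞} (hF : ∀ τ, F τ ≤ M)
    {R : ℝ} (hR : 0 < R) (ρ : ℝ) :
    ∫⁻ τ, F τ ≤
      ENNReal.ofReal (2 * R) * M + ENNReal.ofReal R⁻¹ * ∫⁻ τ, bracketPow 1 (τ + ρ) * F τ := by
  set S := Set.Icc (-ρ - R) (-ρ + R)
  have hpoint : ∀ τ, F τ ≤
      S.indicator (fun _ => M) τ + ENNReal.ofReal R⁻¹ * (bracketPow 1 (τ + ρ) * F τ) := fun τ => by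
    by_cases hτ : τ ∈ S
    · rw [Set.indicator_of_mem hτ]
      exact (hF τ).trans le_self_add
    · refine le_trans ?_ le_add_self
      rw [← mul_assoc]
      refine le_mul_of_one_le_left zero_le ?_
      rw [bracketPow_one, ← ENNReal.ofReal_mul (by positivity), ENNReal.one_le_ofReal,
        ← div_eq_inv_mul, one_le_div hR]
      refine le_trans ?_ (abs_le_bracket _)
      by_contra! hc
      rw [abs_lt] at hc
      exact hτ ⟨by linarith, by linarith⟩
  refine (lintegral_mono hpoint).trans_eq ?_
  rw [lintegral_add_left (measurable_const.indicator measurableSet_Icc),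
    lintegral_indicator measurableSet_Icc, setLIntegral_const, Real.volume_Icc,
    lintegral_const_mul' _ _ ENNReal.ofReal_ne_top, mul_comm M]
  ring_nf

theorem lintegral_enorm_sq_fourierT_le_of_support {g : 𝓢(ℝ, ℂ)} {T : ℝ} (hT : 0 < T)
    (hg : ∀ t, T < |t| → g t = 0) (ρ : ℝ) :
    ∫⁻ τ, ‖fourierT g τ‖ₑ ^ 2 ≤
      ENNReal.ofReal (3 * T) * ∫⁻ τ, bracketPow 1 (τ + ρ) * ‖fourierT g τ‖ₑ ^ 2 := by
  have hpi := Real.pi_pos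
  set A := ∫⁻ τ, ‖fourierT g τ‖ₑ ^ 2 with hA
  set B := ∫⁻ τ, bracketPow 1 (τ + ρ) * ‖fourierT g τ‖ₑ ^ 2
  have hAtop : A ≠ ⊤ := by
    rw [hA, lintegral_enorm_sq_fourierT, lintegral_enorm_sq_eq_ofReal
      ((g.memLp 2).integrable_norm_pow two_ne_zero)]
    exact ENNReal.ofReal_ne_top
  have hsup : ∀ τ, ‖fourierT g τ‖ₑ ^ 2 ≤ ENNReal.ofReal (T / Real.pi) * A := fun τ => by
    rw [hA, lintegral_enorm_sq_fourierT]
    exact enorm_sq_fourierT_le_of_support g.continuous.aestronglyMeasurable hg τ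
  -- The radius `π / (4T)` is chosen so that the sup bound accounts for half of the `L²` mass.
  have hhalf : A ≤ A / 2 + ENNReal.ofReal (4 * T / Real.pi) * B := by
    refine (lintegral_le_add_lintegral_bracketPow_mul hsup
      (R := Real.pi / (4 * T)) (by positivity) ρ).trans_eq ?_
    rw [← mul_assoc, ← ENNReal.ofReal_mul (by positivity), inv_div, div_eq_mul_inv A, mul_comm A,
      ← ENNReal.ofReal_ofNat 2, ← ENNReal.ofReal_inv_of_pos two_pos]
    congr 3
    field_simp
    norm_num
  have habsorb : A / 2 ≤ ENNReal.ofReal (4 * T / Real.pi) * B := by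
    refine ENNReal.le_of_add_le_add_left (a := A / 2)
      (ENNReal.div_lt_top hAtop two_ne_zero).ne ?_
    rwa [ENNReal.add_halves]
  calc A = 2 * (A / 2) := (ENNReal.mul_div_cancel two_ne_zero ENNReal.ofNat_ne_top).symm
    _ ≤ 2 * (ENNReal.ofReal (4 * T / Real.pi) * B) := by gcongr
    _ = ENNReal.ofReal (2 * (4 * T / Real.pi)) * B := by
        rw [ENNReal.ofReal_mul zero_le_two, ENNReal.ofReal_ofNat, mul_assoc]
    _ ≤ ENNReal.ofReal (3 * T) * B := by
        refine mul_le_mul_left (ENNReal.ofReal_le_ofReal ?_) _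
        rw [← mul_div_assoc, div_le_iff₀ hpi]
        nlinarith [Real.pi_gt_three]

theorem bracketPow_le_interpolate {p q T : ℝ} (hp : 0 ≤ p) (hpq : p ≤ q) (hT : 0 < T) (x : ℝ) :
    bracketPow p x ≤
      ENNReal.ofReal (T ^ (q - p)) * bracketPow q x + ENNReal.ofReal (T ^ (-p)) := by
  have hb := bracket_pos x
  rcases le_total T⁻¹ (bracket x) with h | h
  · refine le_trans ?_ le_self_add
    have hsplit : bracketPow p x = bracketPow (p - q) x * bracketPow q x := by
      rw [← bracketPow_add, sub_add_cancel]
    rw [hsplit]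
    refine mul_le_mul_left (ENNReal.ofReal_le_ofReal ?_) _
    calc bracket x ^ (p - q) ≤ T⁻¹ ^ (p - q) :=
          Real.rpow_le_rpow_of_nonpos (by positivity) h (by linarith)
      _ = T ^ (q - p) := by rw [Real.inv_rpow hT.le, ← Real.rpow_neg hT.le, neg_sub]
  · refine le_trans (ENNReal.ofReal_le_ofReal ?_) le_add_self
    calc bracket x ^ p ≤ T⁻¹ ^ p := Real.rpow_le_rpow hb.le h hp
      _ = T ^ (-p) := by rw [Real.inv_rpow hT.le, Real.rpow_neg hT.le]

theorem lintegral_bracketPow_mul_fourierT_le_of_support {g : 𝓢(ℝ, ℂ)} {T p : ℝ} (hT : 0 < T)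
    (hp : 0 ≤ p) (hp1 : p ≤ 1) (hg : ∀ t, T < |t| → g t = 0) (ρ : ℝ) :
    ∫⁻ τ, bracketPow p (τ + ρ) * ‖fourierT g τ‖ₑ ^ 2 ≤
      ENNReal.ofReal (4 * T ^ (1 - p)) *
        ∫⁻ τ, bracketPow 1 (τ + ρ) * ‖fourierT g τ‖ₑ ^ 2 := by
  have hm : Measurable (fourierT g) := (continuous_fourierT g).measurable
  set B := ∫⁻ τ, bracketPow 1 (τ + ρ) * ‖fourierT g τ‖ₑ ^ 2
  have hTpow : T ^ (-p) * (3 * T) = 3 * T ^ (1 - p) := by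
    rw [sub_eq_neg_add, Real.rpow_add hT, Real.rpow_one]
    ring
  calc _ ≤ ∫⁻ τ, (ENNReal.ofReal (T ^ (1 - p)) * (bracketPow 1 (τ + ρ) * ‖fourierT g τ‖ₑ ^ 2) +
        ENNReal.ofReal (T ^ (-p)) * ‖fourierT g τ‖ₑ ^ 2) := by
        refine lintegral_mono fun τ => ?_
        rw [← mul_assoc, ← add_mul]
        gcongr
        exact bracketPow_le_interpolate hp hp1 hT _
    _ = ENNReal.ofReal (T ^ (1 - p)) * B +
        ENNReal.ofReal (T ^ (-p)) * ∫⁻ τ, ‖fourierT g τ‖ₑ ^ 2 := by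
        rw [lintegral_add_left (by fun_prop), lintegral_const_mul' _ _ ENNReal.ofReal_ne_top,
          lintegral_const_mul' _ _ ENNReal.ofReal_ne_top]
    _ ≤ ENNReal.ofReal (T ^ (1 - p)) * B +
        ENNReal.ofReal (T ^ (-p)) * (ENNReal.ofReal (3 * T) * B) := by
        gcongr
        exact lintegral_enorm_sq_fourierT_le_of_support hT hg ρ
    _ = _ := by
        rw [← mul_assoc, ← add_mul, ← ENNReal.ofReal_mul (by positivity), hTpow,
          ← ENNReal.ofReal_add (by positivity) (by positivity)]
        ring_nf

/-! ### Fourier coefficients of periodic functions -/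

theorem norm_exp_neg_I_mul_intCast (x : ℝ) (ξ : ℤ) :
    ‖Complex.exp (-(Complex.I * (x : ℂ) * (ξ : ℂ)))‖ = 1 := by
  rw [Complex.norm_exp]
  simp

theorem fourierX_const_mul (c : ℂ) (g : ℝ → ℂ) (ξ : ℤ) :
    fourierX (fun x => c * g x) ξ = c * fourierX g ξ := by
  unfold fourierX
  simp_rw [mul_left_comm _ c, intervalIntegral.integral_const_mul, mul_left_comm _ c]

theorem norm_fourierX_le {g : ℝ → ℂ} {C : ℝ} (hg : ∀ x, ‖g x‖ ≤ C) (ξ : ℤ) :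
    ‖fourierX g ξ‖ ≤ fourierConst * (C * (2 * Real.pi)) := by
  have hpi := Real.two_pi_pos
  unfold fourierX
  rw [norm_mul, Complex.norm_real, Real.norm_of_nonneg (by positivity)]
  refine mul_le_mul_of_nonneg_left ?_ fourierConst_pos.le
  refine (intervalIntegral.norm_integral_le_of_norm_le_const (C := C) fun x _ => ?_).trans_eq ?_
  · rw [norm_mul, norm_exp_neg_I_mul_intCast, one_mul]
    exact hg x
  · rw [sub_zero, abs_of_pos hpi]

theorem fourierX_deriv {g : ℝ → ℂ} (hg : ContDiff ℝ 1 g)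
    (hper : Function.Periodic g (2 * Real.pi)) (ξ : ℤ) :
    fourierX (deriv g) ξ = Complex.I * ξ * fourierX g ξ := by
  have hexp_deriv : ∀ x : ℝ,
      HasDerivAt (fun x : ℝ => Complex.exp (-(Complex.I * (x : ℂ) * (ξ : ℂ))))
        (Complex.exp (-(Complex.I * (x : ℂ) * (ξ : ℂ))) * (-(Complex.I * ξ))) x := fun x => by
    refine HasDerivAt.cexp ?_
    simpa using (((hasDerivAt_id x).ofReal_comp.const_mul Complex.I).mul_const (ξ : ℂ)).fun_neg
  have hparts := intervalIntegral.integral_mul_deriv_eq_deriv_mul (a := 0) (b := 2 * Real.pi)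
    (fun x _ => hexp_deriv x) (fun x _ => (hg.differentiable one_ne_zero x).hasDerivAt)
    (Continuous.intervalIntegrable (by fun_prop) _ _)
    ((hg.continuous_deriv le_rfl).intervalIntegrable _ _)
  have hexp_two_pi : Complex.exp (-(Complex.I * ((2 * Real.pi : ℝ) : ℂ) * (ξ : ℂ))) = 1 :=
    Complex.exp_eq_one_iff.2 ⟨-ξ, by push_cast; ring⟩
  have hends : g (2 * Real.pi) = g 0 := by simpa using hper 0
  have hintegral : ∫ x in (0 : ℝ)..(2 * Real.pi),
        Complex.exp (-(Complex.I * (x : ℂ) * (ξ : ℂ))) * deriv g x =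
      Complex.I * ξ * ∫ x in (0 : ℝ)..(2 * Real.pi),
        Complex.exp (-(Complex.I * (x : ℂ) * (ξ : ℂ))) * g x := by
    rw [hparts, hexp_two_pi, hends]
    simp only [Complex.ofReal_zero, mul_zero, zero_mul, neg_zero, Complex.exp_zero, sub_self,
      zero_sub]
    rw [← intervalIntegral.integral_neg, ← intervalIntegral.integral_const_mul]
    refine intervalIntegral.integral_congr fun x _ => ?_
    ring
  unfold fourierX
  rw [hintegral, mul_left_comm]

theorem fourierCoeff_lift_eq {g : ℝ → ℂ} (hper : Function.Periodic g (2 * Real.pi))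
    [Fact (0 < 2 * Real.pi)] (ξ : ℤ) :
    fourierCoeff hper.lift ξ = fourierConst * fourierX g ξ := by
  have hpi : (Real.pi : ℂ) ≠ 0 := by exact_mod_cast Real.pi_ne_zero
  rw [fourierCoeff_eq_intervalIntegral (hper.lift : AddCircle (2 * Real.pi) → ℂ) ξ 0]
  unfold fourierX
  change _ = (fourierConst : ℂ) * ((fourierConst : ℂ) * _)
  rw [← mul_assoc, ← Complex.ofReal_mul, fourierConst_mul_self, Complex.real_smul, zero_add,
    one_div]
  congr 1
  refine intervalIntegral.integral_congr fun x _ => ?_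
  simp only [smul_eq_mul, Function.Periodic.lift_coe]
  rw [fourier_coe_apply]
  congr 2
  push_cast
  field_simp

theorem hasSum_fourierX {g : ℝ → ℂ} (hg : Continuous g) (hper : Function.Periodic g (2 * Real.pi))
    (hsum : Summable (fourierX g)) (x : ℝ) :
    HasSum (fun ξ : ℤ => fourierConst * (Complex.exp (Complex.I * x * ξ) * fourierX g ξ))
      (g x) := by
  have : Fact (0 < 2 * Real.pi) := ⟨Real.two_pi_pos⟩
  have hpi : (Real.pi : ℂ) ≠ 0 := by exact_mod_cast Real.pi_ne_zero
  let F : C(AddCircle (2 * Real.pi), ℂ) := ⟨hper.lift, continuous_coinduced_dom.2 hg⟩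
  have hcoeff : ∀ ξ : ℤ, fourierCoeff F ξ = fourierConst * fourierX g ξ :=
    fourierCoeff_lift_eq hper
  have hF : Summable (fourierCoeff F) := by
    rw [funext hcoeff]
    exact hsum.mul_left _
  convert has_pointwise_sum_fourier_series_of_summable hF (x : AddCircle (2 * Real.pi)) using 2
    with ξ
  swap
  · rfl
  have hphase : 2 * (Real.pi : ℂ) * Complex.I * ξ * x / ((2 * Real.pi : ℝ) : ℂ) =
      Complex.I * x * ξ := by
    push_cast
    field_simp
  rw [hcoeff, fourier_coe_apply, smul_eq_mul, hphase]
  ring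

/-! ### The space of periodic functions of rapid decay -/

/-- The partial derivative in the space variable. -/
def derivX (f : ℝ → ℝ → ℂ) (t x : ℝ) : ℂ := deriv (f t) x

/-- The partial derivative in the time variable. -/
def derivT (f : ℝ → ℝ → ℂ) (t x : ℝ) : ℂ := deriv (fun s => f s x) t

namespace IsSPer

variable {f g : ℝ → ℝ → ℂ}

theorem continuous_uncurry (hf : IsSPer f) : Continuous fun p : ℝ × ℝ => f p.1 p.2 :=
  hf.smooth.continuous

theorem contDiff_x (hf : IsSPer f) (t : ℝ) : ContDiff ℝ ∞ (f t) :=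
  hf.smooth.comp (contDiff_prodMk_right t)

theorem contDiff_t (hf : IsSPer f) (x : ℝ) : ContDiff ℝ ∞ fun t => f t x :=
  hf.smooth.comp (contDiff_prodMk_left x)

theorem mul (hf : IsSPer f) (hg : IsSPer g) : IsSPer fun t x => f t x * g t x where
  periodic t x := by rw [hf.periodic, hg.periodic]
  smooth := hf.smooth.mul hg.smooth
  decay k n := by
    choose C hC using hf.decay k
    choose D hD using hg.decay 0
    refine ⟨∑ i ∈ Finset.range (n + 1), n.choose i * C i * D (n - i), fun t x => ?_⟩
    refine (mul_le_mul_of_nonneg_left (norm_iteratedFDeriv_mul_le hf.smooth hg.smooth (t, x)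
      (mod_cast le_top)) (by positivity)).trans ?_
    rw [Finset.mul_sum]
    refine Finset.sum_le_sum fun i _ => ?_
    have hCi := hC i t x
    have hDi := hD (n - i) t x
    rw [pow_zero, one_mul] at hDi
    calc _ = n.choose i * (|t| ^ k * ‖iteratedFDeriv ℝ i (fun p : ℝ × ℝ => f p.1 p.2) (t, x)‖) *
          ‖iteratedFDeriv ℝ (n - i) (fun p : ℝ × ℝ => g p.1 p.2) (t, x)‖ := by ring
      _ ≤ _ := by
        have hC0 : 0 ≤ C i := le_trans (by positivity) hCi
        gcongr

theorem fderiv_apply (hf : IsSPer f) (v : ℝ × ℝ) :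
    IsSPer fun t x => fderiv ℝ (fun p : ℝ × ℝ => f p.1 p.2) (t, x) v where
  periodic t x := by
    have hshift : (fun p : ℝ × ℝ => f (p + (0, 2 * Real.pi)).1 (p + (0, 2 * Real.pi)).2) =
        fun p => f p.1 p.2 := by
      ext p
      simp [hf.periodic]
    have h := fderiv_comp_add_right (𝕜 := ℝ) (f := fun p : ℝ × ℝ => f p.1 p.2) (x := (t, x))
      (0, 2 * Real.pi)
    rw [hshift] at h
    simp [h]
  smooth := (hf.smooth.fderiv_right (m := ∞) (by simp)).clm_apply contDiff_const
  decay k n := by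
    obtain ⟨C, hC⟩ := hf.decay k (n + 1)
    refine ⟨‖v‖ * C, fun t x => ?_⟩
    have hle := norm_iteratedFDeriv_clm_apply_const (c := v) (n := n) (N := ∞) (x := (t, x))
      (hf.smooth.fderiv_right (m := ∞) (by simp)).contDiffAt (mod_cast le_top)
    rw [norm_iteratedFDeriv_fderiv] at hle
    calc _ ≤ |t| ^ k * (‖v‖ *
          ‖iteratedFDeriv ℝ (n + 1) (fun p : ℝ × ℝ => f p.1 p.2) (t, x)‖) := by gcongr
      _ = ‖v‖ * (|t| ^ k * ‖iteratedFDeriv ℝ (n + 1) (fun p : ℝ × ℝ => f p.1 p.2) (t, x)‖) := by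
        ring
      _ ≤ _ := mul_le_mul_of_nonneg_left (hC t x) (norm_nonneg _)

theorem derivX (hf : IsSPer f) : IsSPer (derivX f) := by
  convert hf.fderiv_apply (0, 1) using 3 with t x
  exact (HasFDerivAt.comp_hasDerivAt x (hf.smooth.differentiable (by simp) (t, x)).hasFDerivAt
    ((hasDerivAt_const x t).prodMk (hasDerivAt_id x))).deriv

theorem derivT (hf : IsSPer f) : IsSPer (derivT f) := by
  convert hf.fderiv_apply (1, 0) using 3 with t x
  exact (HasFDerivAt.comp_hasDerivAt t (hf.smooth.differentiable (by simp) (t, x)).hasFDerivAt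
    ((hasDerivAt_id t).prodMk (hasDerivAt_const t x))).deriv

theorem exists_pow_mul_norm_le (hf : IsSPer f) (k : ℕ) :
    ∃ C : ℝ≥0, ∀ t x, |t| ^ k * ‖f t x‖ ≤ C := by
  obtain ⟨C, hC⟩ := hf.decay k 0
  refine ⟨C.toNNReal, fun t x => ?_⟩
  have h := hC t x
  rw [norm_iteratedFDeriv_zero] at h
  exact h.trans (Real.le_coe_toNNReal C)

end IsSPer

/-! ### Decay of the transforms -/

theorem enorm_le_mul_bracketPow_neg_two {v : ℂ} {C : ℝ≥0} {x : ℝ} (h : (1 + x ^ 2) * ‖v‖ ≤ C) :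
    ‖v‖ₑ ≤ C * bracketPow (-2) x := by
  have hb := bracket_pos x
  unfold bracketPow
  rw [← ofReal_norm, ← ENNReal.ofReal_coe_nnreal, ← ENNReal.ofReal_mul C.coe_nonneg]
  refine ENNReal.ofReal_le_ofReal ?_
  rw [Real.rpow_neg hb.le, Real.rpow_two, bracket_sq, ← div_eq_mul_inv,
    le_div_iff₀' (by positivity)]
  exact h

theorem enorm_le_mul_bracketPow_neg_two_of_sq_mul {v : ℂ} {C : ℝ≥0∞} {x : ℝ} (h₀ : ‖v‖ₑ ≤ C)
    (h₂ : ‖(x : ℂ) ^ 2 * v‖ₑ ≤ C) : ‖v‖ₑ ≤ 2 * C * bracketPow (-2) x := by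
  have hsq : bracketPow 2 x = 1 + ‖(x : ℂ) ^ 2‖ₑ := by
    rw [bracketPow, Real.rpow_two, bracket_sq, ENNReal.ofReal_add zero_le_one (sq_nonneg x),
      ENNReal.ofReal_one, ← ofReal_norm, norm_pow, Complex.norm_real, Real.norm_eq_abs, sq_abs]
  calc ‖v‖ₑ = bracketPow 2 x * ‖v‖ₑ * bracketPow (-2) x := by
        rw [mul_right_comm, bracketPow_mul_bracketPow_neg, one_mul]
    _ = (‖v‖ₑ + ‖(x : ℂ) ^ 2 * v‖ₑ) * bracketPow (-2) x := by
        rw [hsq, add_mul, one_mul, enorm_mul]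
    _ ≤ 2 * C * bracketPow (-2) x := by
        rw [two_mul]
        gcongr

theorem enorm_I_mul_I_mul (x v : ℂ) : ‖Complex.I * x * (Complex.I * x * v)‖ₑ = ‖x ^ 2 * v‖ₑ := by
  rw [← enorm_neg (x ^ 2 * v)]
  congr 1
  linear_combination x ^ 2 * v * Complex.I_sq

theorem lintegral_bracketPow_freqMeasure_lt_top {p : ℝ} (hp : 1 < p) :
    ∫⁻ k, bracketPow (-p) k.1 * bracketPow (-p) k.2 ∂freqMeasure < ⊤ := by
  rw [lintegral_freqMeasure (by fun_prop)]
  simp_rw [lintegral_const_mul' _ _ (bracketPow_ne_top _ _), ENNReal.tsum_mul_right]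
  exact ENNReal.mul_lt_top (tsum_bracketPow_lt_top hp) (lintegral_bracketPow_lt_top hp)

namespace IsSPer

variable {f g : ℝ → ℝ → ℂ}

theorem exists_pow_mul_norm_fourierX_le (hf : IsSPer f) (k : ℕ) :
    ∃ C : ℝ≥0, ∀ t ξ, |t| ^ k * ‖fourierX (f t) ξ‖ ≤ C := by
  obtain ⟨C, hC⟩ := hf.exists_pow_mul_norm_le k
  refine ⟨⟨fourierConst * (C * (2 * Real.pi)), by have := fourierConst_pos; positivity⟩,
    fun t ξ => ?_⟩
  have hnorm (v : ℂ) : ‖((|t| ^ k : ℝ) : ℂ) * v‖ = |t| ^ k * ‖v‖ := by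
    rw [norm_mul, Complex.norm_real, Real.norm_of_nonneg (by positivity)]
  rw [← hnorm, ← fourierX_const_mul]
  exact norm_fourierX_le (fun x => (hnorm _).trans_le (hC t x)) ξ

theorem hasDerivAt_fourierX (hf : IsSPer f) (ξ : ℤ) (t : ℝ) :
    HasDerivAt (fun s => fourierX (f s) ξ) (fourierX (PeriodicBourgain.derivT f t) ξ) t := by
  obtain ⟨C, hC⟩ := hf.derivT.exists_pow_mul_norm_le 0
  have hexp : Continuous fun x : ℝ => Complex.exp (-(Complex.I * (x : ℂ) * (ξ : ℂ))) := by fun_prop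
  unfold fourierX
  refine HasDerivAt.const_mul _ (intervalIntegral.hasDerivAt_integral_of_dominated_loc_of_deriv_le
    (s := Set.univ) (bound := fun _ => C) Filter.univ_mem
    (.of_forall fun s => (hexp.mul (hf.contDiff_x s).continuous).aestronglyMeasurable)
    ((hexp.mul (hf.contDiff_x t).continuous).intervalIntegrable _ _)
    (hexp.mul (hf.derivT.contDiff_x t).continuous).aestronglyMeasurable
    (.of_forall fun x _ s _ => ?_) intervalIntegrable_const
    (.of_forall fun x _ s _ =>
      ((hf.contDiff_t x).differentiable (by simp) s).hasDerivAt.const_mul _)).2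
  rw [norm_mul, norm_exp_neg_I_mul_intCast, one_mul]
  exact (one_mul _).symm.trans_le (hC s x)

theorem deriv_fourierX (hf : IsSPer f) (ξ : ℤ) :
    deriv (fun t => fourierX (f t) ξ) = fun t => fourierX (PeriodicBourgain.derivT f t) ξ :=
  funext fun t => (hf.hasDerivAt_fourierX ξ t).deriv

theorem contDiff_fourierX (hf : IsSPer f) (ξ : ℤ) : ContDiff ℝ ∞ fun t => fourierX (f t) ξ := by
  rw [contDiff_infty]
  intro n
  induction n generalizing f with
  | zero =>
    rw [Nat.cast_zero, contDiff_zero]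
    exact continuous_iff_continuousAt.2 fun t => (hf.hasDerivAt_fourierX ξ t).continuousAt
  | succ n ih =>
    rw [Nat.cast_succ, contDiff_succ_iff_deriv, hf.deriv_fourierX]
    exact ⟨fun t => (hf.hasDerivAt_fourierX ξ t).differentiableAt,
      fun h => absurd h (by simp), ih hf.derivT⟩

theorem exists_pow_mul_iteratedDeriv_fourierX_le (hf : IsSPer f) (ξ : ℤ) (k n : ℕ) :
    ∃ C : ℝ≥0, ∀ t, |t| ^ k * ‖iteratedDeriv n (fun s => fourierX (f s) ξ) t‖ ≤ C := by
  induction n generalizing f with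
  | zero =>
    obtain ⟨C, hC⟩ := hf.exists_pow_mul_norm_fourierX_le k
    exact ⟨C, fun t => by simpa only [iteratedDeriv_zero] using hC t ξ⟩
  | succ n ih =>
    simp_rw [iteratedDeriv_succ', hf.deriv_fourierX]
    exact ih hf.derivT

/-- The Fourier coefficient `t ↦ f̂(t, ξ)` as a Schwartz function of time. -/
def fourierXSchwartz (hf : IsSPer f) (ξ : ℤ) : 𝓢(ℝ, ℂ) where
  toFun t := fourierX (f t) ξ
  smooth' := hf.contDiff_fourierX ξ
  decay' k n := by
    obtain ⟨C, hC⟩ := hf.exists_pow_mul_iteratedDeriv_fourierX_le ξ k n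
    exact ⟨C, fun t => by
      rw [norm_iteratedFDeriv_eq_norm_iteratedDeriv, Real.norm_eq_abs]
      exact hC t⟩

theorem fourierX_derivX (hf : IsSPer f) (t : ℝ) (ξ : ℤ) :
    fourierX (PeriodicBourgain.derivX f t) ξ = Complex.I * ξ * fourierX (f t) ξ :=
  fourierX_deriv ((hf.contDiff_x t).of_le (by simp)) (hf.periodic t) ξ

theorem fourierTX_derivT (hf : IsSPer f) (τ : ℝ) (ξ : ℤ) :
    fourierTX (PeriodicBourgain.derivT f) τ ξ = Complex.I * τ * fourierTX f τ ξ := by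
  unfold fourierTX
  rw [← hf.deriv_fourierX]
  have hderiv : Integrable (deriv fun t => fourierX (f t) ξ) := by
    rw [hf.deriv_fourierX]
    exact (hf.derivT.fourierXSchwartz ξ).integrable
  exact fourierT_deriv (hf.fourierXSchwartz ξ).integrable (hf.fourierXSchwartz ξ).differentiable
    hderiv τ

theorem fourierTX_derivX (hf : IsSPer f) (τ : ℝ) (ξ : ℤ) :
    fourierTX (PeriodicBourgain.derivX f) τ ξ = Complex.I * ξ * fourierTX f τ ξ := by
  unfold fourierTX fourierT
  simp_rw [hf.fourierX_derivX, mul_left_comm _ (Complex.I * (ξ : ℂ)), integral_const_mul,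
    mul_left_comm _ (Complex.I * (ξ : ℂ))]

theorem exists_enorm_le (hf : IsSPer f) :
    ∃ C : ℝ≥0, ∀ t x, ‖f t x‖ₑ ≤ C * bracketPow (-2) t := by
  obtain ⟨C₀, h₀⟩ := hf.exists_pow_mul_norm_le 0
  obtain ⟨C₂, h₂⟩ := hf.exists_pow_mul_norm_le 2
  refine ⟨C₀ + C₂, fun t x => enorm_le_mul_bracketPow_neg_two ?_⟩
  have hC₀ := h₀ t x
  have hC₂ := h₂ t x
  rw [pow_zero] at hC₀
  rw [sq_abs] at hC₂
  push_cast
  linarith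

theorem exists_enorm_fourierX_le (hf : IsSPer f) :
    ∃ C : ℝ≥0, ∀ t ξ, ‖fourierX (f t) ξ‖ₑ ≤ C * bracketPow (-2) t := by
  obtain ⟨C₀, h₀⟩ := hf.exists_pow_mul_norm_fourierX_le 0
  obtain ⟨C₂, h₂⟩ := hf.exists_pow_mul_norm_fourierX_le 2
  refine ⟨C₀ + C₂, fun t ξ => enorm_le_mul_bracketPow_neg_two ?_⟩
  have hC₀ := h₀ t ξ
  have hC₂ := h₂ t ξ
  rw [pow_zero] at hC₀
  rw [sq_abs] at hC₂
  push_cast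
  linarith

theorem exists_enorm_fourierX_le_mul (hf : IsSPer f) :
    ∃ C : ℝ≥0, ∀ t ξ, ‖fourierX (f t) ξ‖ₑ ≤ C * (bracketPow (-2) t * bracketPow (-2) ξ) := by
  obtain ⟨C₀, h₀⟩ := hf.exists_enorm_fourierX_le
  obtain ⟨C₂, h₂⟩ := hf.derivX.derivX.exists_enorm_fourierX_le
  refine ⟨2 * (C₀ + C₂), fun t ξ => ?_⟩
  have h := enorm_le_mul_bracketPow_neg_two_of_sq_mul (v := fourierX (f t) ξ) (x := ξ)
    (C := (C₀ + C₂) * bracketPow (-2) t) ?_ ?_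
  · refine h.trans_eq ?_
    push_cast
    ring
  · refine (h₀ t ξ).trans ?_
    gcongr
    exact le_self_add
  · rw [Complex.ofReal_intCast, ← enorm_I_mul_I_mul, ← hf.fourierX_derivX,
      ← hf.derivX.fourierX_derivX]
    refine (h₂ t ξ).trans ?_
    gcongr
    exact le_add_self

theorem summable_fourierX (hf : IsSPer f) (t : ℝ) : Summable (fourierX (f t)) := by
  obtain ⟨C, hC⟩ := hf.exists_enorm_fourierX_le_mul
  refine .of_enorm (ne_top_of_le_ne_top ?_ (ENNReal.tsum_le_tsum (hC t)))
  rw [ENNReal.tsum_mul_left, ENNReal.tsum_mul_left]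
  exact ENNReal.mul_ne_top ENNReal.coe_ne_top
    (ENNReal.mul_ne_top (bracketPow_ne_top _ _) (tsum_bracketPow_lt_top one_lt_two).ne)

theorem exists_enorm_fourierTX_le_bracketPow (hf : IsSPer f) :
    ∃ C : ℝ≥0, ∀ τ ξ, ‖fourierTX f τ ξ‖ₑ ≤ C * bracketPow (-2) ξ := by
  obtain ⟨C, hC⟩ := hf.exists_enorm_fourierX_le_mul
  set I := ∫⁻ t, bracketPow (-2) t with hI
  have hItop : I ≠ ⊤ := (lintegral_bracketPow_lt_top one_lt_two).ne
  refine ⟨‖(fourierConst : ℂ)‖₊ * (C * I.toNNReal), fun τ ξ => ?_⟩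
  calc ‖fourierTX f τ ξ‖ₑ ≤ ‖(fourierConst : ℂ)‖ₑ * ∫⁻ t, ‖fourierX (f t) ξ‖ₑ :=
        enorm_fourierT_le _ τ
    _ ≤ ‖(fourierConst : ℂ)‖ₑ * ∫⁻ t, C * (bracketPow (-2) t * bracketPow (-2) ξ) := by
        gcongr with t
        exact hC t ξ
    _ = _ := by
        rw [lintegral_const_mul' _ _ ENNReal.coe_ne_top,
          lintegral_mul_const' _ _ (bracketPow_ne_top _ _), ← hI]
        push_cast
        rw [ENNReal.coe_toNNReal hItop, enorm_eq_nnnorm]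
        ring

theorem exists_enorm_fourierTX_le (hf : IsSPer f) :
    ∃ C : ℝ≥0, ∀ τ ξ, ‖fourierTX f τ ξ‖ₑ ≤ C * (bracketPow (-2) ξ * bracketPow (-2) τ) := by
  obtain ⟨C₀, h₀⟩ := hf.exists_enorm_fourierTX_le_bracketPow
  obtain ⟨C₂, h₂⟩ := hf.derivT.derivT.exists_enorm_fourierTX_le_bracketPow
  refine ⟨2 * (C₀ + C₂), fun τ ξ => ?_⟩
  have h := enorm_le_mul_bracketPow_neg_two_of_sq_mul (v := fourierTX f τ ξ) (x := τ)
    (C := (C₀ + C₂) * bracketPow (-2) ξ) ?_ ?_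
  · refine h.trans_eq ?_
    push_cast
    ring
  · refine (h₀ τ ξ).trans ?_
    gcongr
    exact le_self_add
  · rw [← enorm_I_mul_I_mul, ← hf.fourierTX_derivT, ← hf.derivT.fourierTX_derivT]
    refine (h₂ τ ξ).trans ?_
    gcongr
    exact le_add_self

theorem measurable_fourierTX (hf : IsSPer f) :
    Measurable fun p : ℤ × ℝ => fourierTX f p.2 p.1 :=
  measurable_from_prod_countable_right fun ξ =>
    (continuous_fourierT (hf.fourierXSchwartz ξ)).measurable

theorem integrable_fourierTX (hf : IsSPer f) :
    Integrable (fun p : ℤ × ℝ => fourierTX f p.2 p.1) freqMeasure := by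
  obtain ⟨C, hC⟩ := hf.exists_enorm_fourierTX_le
  refine ⟨hf.measurable_fourierTX.aestronglyMeasurable, ?_⟩
  refine (lintegral_mono fun p : ℤ × ℝ => hC p.2 p.1).trans_lt ?_
  rw [lintegral_const_mul' _ _ ENNReal.coe_ne_top]
  exact ENNReal.mul_lt_top ENNReal.coe_lt_top (lintegral_bracketPow_freqMeasure_lt_top one_lt_two)

end IsSPer

/-! ### Space-time inversion and the transform of a product -/

/-- The character `e^{i(tτ + xξ)}` of frequency `p = (ξ, τ)` at `z = (t, x)`. -/
def character (p : ℤ × ℝ) (z : ℝ × ℝ) : ℂ :=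
  Complex.exp (Complex.I * (z.1 * p.2 + z.2 * p.1))

theorem norm_character (p : ℤ × ℝ) (z : ℝ × ℝ) : ‖character p z‖ = 1 := by
  unfold character
  rw [Complex.norm_exp]
  simp

@[fun_prop]
theorem measurable_character : Measurable fun w : (ℤ × ℝ) × (ℝ × ℝ) => character w.1 w.2 := by
  unfold character
  fun_prop

theorem character_neg_sub (p q : ℤ × ℝ) (z : ℝ × ℝ) :
    character (-(p - q)) z = character (-p) z * character q z := by
  unfold character
  rw [← Complex.exp_add]
  congr 1
  simp only [Prod.fst_neg, Prod.snd_neg, Prod.fst_sub, Prod.snd_sub]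
  push_cast
  ring

/-- The Lebesgue measure on the period strip `ℝ × (0, 2π]`, over which the space-time transform
integrates. -/
def stripMeasure : Measure (ℝ × ℝ) :=
  (volume : Measure ℝ).prod (volume.restrict (Set.Ioc 0 (2 * Real.pi)))

instance : SFinite stripMeasure := by unfold stripMeasure; infer_instance

namespace IsSPer

variable {f g : ℝ → ℝ → ℂ}

theorem integrable_stripMeasure (hf : IsSPer f) :
    Integrable (fun z : ℝ × ℝ => f z.1 z.2) stripMeasure := by
  obtain ⟨C, hC⟩ := hf.exists_enorm_le
  refine ⟨hf.continuous_uncurry.aestronglyMeasurable, ?_⟩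
  refine (lintegral_mono fun z : ℝ × ℝ => hC z.1 z.2).trans_lt ?_
  rw [lintegral_const_mul' _ _ ENNReal.coe_ne_top, stripMeasure, lintegral_prod _ (by fun_prop)]
  simp_rw [lintegral_const, Measure.restrict_apply_univ]
  rw [lintegral_mul_const _ (by fun_prop), Real.volume_Ioc]
  exact ENNReal.mul_lt_top ENNReal.coe_lt_top
    (ENNReal.mul_lt_top (lintegral_bracketPow_lt_top one_lt_two) ENNReal.ofReal_lt_top)

theorem fourierTX_eq_integral (hf : IsSPer f) (p : ℤ × ℝ) :
    fourierTX f p.2 p.1 = ((2 * Real.pi)⁻¹ : ℝ) *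
      ∫ z, character (-p) z * f z.1 z.2 ∂stripMeasure := by
  have hint : Integrable (fun z : ℝ × ℝ => character (-p) z * f z.1 z.2) stripMeasure :=
    hf.integrable_stripMeasure.bdd_mul (c := 1)
      (measurable_character.comp measurable_prodMk_left).aestronglyMeasurable
      (.of_forall fun z => (norm_character _ z).le)
  have hphase (t x : ℝ) : character (-p) (t, x) =
      Complex.exp (-(Complex.I * t * p.2)) * Complex.exp (-(Complex.I * x * p.1)) := by
    rw [character, ← Complex.exp_add]
    congr 1
    simp only [Prod.fst_neg, Prod.snd_neg]
    push_cast
    ring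
  unfold stripMeasure at hint ⊢
  rw [integral_prod _ hint, ← fourierConst_mul_self, Complex.ofReal_mul,
    mul_assoc, ← integral_const_mul]
  unfold fourierTX fourierT
  change (fourierConst : ℂ) * _ = _
  congr 1
  refine integral_congr_ae (.of_forall fun t => ?_)
  unfold fourierX
  change _ * ((fourierConst : ℂ) * _) = (fourierConst : ℂ) * _
  rw [mul_left_comm, intervalIntegral.integral_of_le Real.two_pi_pos.le, ← integral_const_mul]
  simp_rw [hphase, mul_assoc]

theorem inversion (hf : IsSPer f) (z : ℝ × ℝ) :
    f z.1 z.2 = ((2 * Real.pi)⁻¹ : ℝ) *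
      ∫ p, character p z * fourierTX f p.2 p.1 ∂freqMeasure := by
  have hint : Integrable (fun p : ℤ × ℝ => character p z * fourierTX f p.2 p.1) freqMeasure :=
    hf.integrable_fourierTX.bdd_mul (c := 1)
      (measurable_character.comp measurable_prodMk_right).aestronglyMeasurable
      (.of_forall fun p => (norm_character p z).le)
  have htime (ξ : ℤ) : (fourierConst : ℂ) * ∫ τ : ℝ, character (ξ, τ) z * fourierTX f τ ξ =
      Complex.exp (Complex.I * z.2 * ξ) * fourierX (f z.1) ξ := by
    have hphase (τ : ℝ) : character (ξ, τ) z =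
        Complex.exp (Complex.I * z.2 * ξ) * Complex.exp (Complex.I * z.1 * τ) := by
      rw [character, ← Complex.exp_add]
      congr 1
      ring
    have hinv := fourierT_inversion (hf.fourierXSchwartz ξ) z.1
    change fourierX (f z.1) ξ = fourierConst *
      ∫ τ : ℝ, Complex.exp (Complex.I * z.1 * τ) * fourierTX f τ ξ at hinv
    simp_rw [hphase, mul_assoc (Complex.exp (Complex.I * z.2 * ξ))]
    rw [integral_const_mul, mul_left_comm, hinv]
  have hcount (ξ : ℤ) : (Measure.count : Measure ℤ).real {ξ} = 1 := by simp [Measure.real]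
  unfold freqMeasure at hint ⊢
  rw [integral_prod _ hint, integral_countable hint.integral_prod_left,
    ← fourierConst_mul_self, Complex.ofReal_mul, mul_assoc, ← tsum_mul_left, ← tsum_mul_left]
  simp_rw [hcount, one_smul, htime]
  exact (hasSum_fourierX (hf.contDiff_x z.1).continuous (hf.periodic z.1)
    (hf.summable_fourierX z.1) z.2).tsum_eq.symm

theorem fourierTX_mul (hf : IsSPer f) (hg : IsSPer g) (p : ℤ × ℝ) :
    fourierTX (fun t x => f t x * g t x) p.2 p.1 = ((2 * Real.pi)⁻¹ : ℝ) *
      ∫ q : ℤ × ℝ, fourierTX f q.2 q.1 * fourierTX g (p - q).2 (p - q).1 ∂freqMeasure := by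
  have hint : Integrable (Function.uncurry fun (z : ℝ × ℝ) (q : ℤ × ℝ) =>
      character (-(p - q)) z * (g z.1 z.2 * fourierTX f q.2 q.1))
      (stripMeasure.prod freqMeasure) :=
    (hg.integrable_stripMeasure.mul_prod hf.integrable_fourierTX).bdd_mul (c := 1)
      (measurable_character.comp (f := fun v : (ℝ × ℝ) × (ℤ × ℝ) => (-(p - v.2), v.1))
        (by fun_prop)).aestronglyMeasurable
      (.of_forall fun v => (norm_character _ _).le)
  rw [(hf.mul hg).fourierTX_eq_integral p]
  congr 1
  calc ∫ z, character (-p) z * (f z.1 z.2 * g z.1 z.2) ∂stripMeasure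
      = ∫ z, ((2 * Real.pi)⁻¹ : ℝ) * ∫ q, character (-(p - q)) z *
          (g z.1 z.2 * fourierTX f q.2 q.1) ∂freqMeasure ∂stripMeasure := by
        refine integral_congr_ae (.of_forall fun z => ?_)
        simp only [character_neg_sub]
        rw [hf.inversion z, mul_assoc, mul_left_comm, mul_comm (∫ q, _ ∂freqMeasure),
          ← mul_assoc (character _ _), ← integral_const_mul]
        congr 2
        ext q
        ring
    _ = ((2 * Real.pi)⁻¹ : ℝ) * ∫ q, ∫ z, character (-(p - q)) z *
          (g z.1 z.2 * fourierTX f q.2 q.1) ∂stripMeasure ∂freqMeasure := by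
        rw [integral_const_mul, integral_integral_swap hint]
    _ = _ := by
        rw [← integral_const_mul]
        refine integral_congr_ae (.of_forall fun q => ?_)
        beta_reduce
        rw [hg.fourierTX_eq_integral (p - q), mul_left_comm (fourierTX f q.2 q.1),
          ← integral_const_mul (fourierTX f q.2 q.1)]
        congr 1
        refine integral_congr_ae (.of_forall fun z => ?_)
        ring

theorem enorm_fourierTX_mul_le (hf : IsSPer f) (hg : IsSPer g) (p : ℤ × ℝ) :
    ‖fourierTX (fun t x => f t x * g t x) p.2 p.1‖ₑ ≤
      ∫⁻ q : ℤ × ℝ, ‖fourierTX f q.2 q.1‖ₑ * ‖fourierTX g (p - q).2 (p - q).1‖ₑ ∂freqMeasure := by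
  have hconst : ‖((2 * Real.pi : ℝ) : ℂ)⁻¹‖ₑ ≤ 1 := by
    rw [← ofReal_norm, norm_inv, Complex.norm_real, Real.norm_of_nonneg Real.two_pi_pos.le,
      ENNReal.ofReal_le_one]
    refine inv_le_one_of_one_le₀ ?_
    linarith [Real.pi_gt_three]
  rw [hf.fourierTX_mul hg, enorm_mul]
  refine (mul_le_of_le_one_left' ?_).trans ((enorm_integral_le_lintegral_enorm _).trans_eq ?_)
  · exact_mod_cast hconst
  · simp_rw [enorm_mul]

end IsSPer

/-- The modulus of the space-time Fourier transform, as a function on the frequency space. -/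
def absFourier (f : ℝ → ℝ → ℂ) (p : ℤ × ℝ) : ℝ≥0∞ := ‖fourierTX f p.2 p.1‖ₑ

theorem IsSPer.measurable_absFourier {f : ℝ → ℝ → ℂ} (hf : IsSPer f) : Measurable (absFourier f) :=
  hf.measurable_fourierTX.enorm

theorem absFourier_derivX {f : ℝ → ℝ → ℂ} (hf : IsSPer f) (p : ℤ × ℝ) :
    absFourier (derivX f) p = ENNReal.ofReal |(p.1 : ℝ)| * absFourier f p := by
  unfold absFourier
  rw [hf.fourierTX_derivX, enorm_mul, enorm_mul, ← ofReal_norm, ← ofReal_norm, Complex.norm_I,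
    Complex.norm_intCast, ENNReal.ofReal_one, one_mul]

theorem absFourier_mul_mul_derivX_le {u₁ u₂ u₃ : ℝ → ℝ → ℂ} (h₁ : IsSPer u₁) (h₂ : IsSPer u₂)
    (h₃ : IsSPer u₃) (p₀ : ℤ × ℝ) :
    absFourier (fun t x => u₁ t x * u₂ t x * derivX u₃ t x) p₀ ≤
      ∫⁻ w : (ℤ × ℝ) × (ℤ × ℝ), absFourier u₁ w.1 * (absFourier u₂ w.2 *
        (ENNReal.ofReal |((freqThree (p₀, w)).1 : ℝ)| * absFourier u₃ (-freqThree (p₀, w))))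
        ∂(freqMeasure.prod freqMeasure) := by
  have hm₁ := h₁.measurable_absFourier
  have hm₂ := h₂.measurable_absFourier
  have hm₃ := h₃.measurable_absFourier
  have hneg (p₁ p₂ : ℤ × ℝ) : p₀ - p₁ - p₂ = -freqThree (p₀, p₁, p₂) := by
    unfold freqThree
    abel
  rw [lintegral_prod _ (by fun_prop)]
  simp_rw [mul_assoc (u₁ _ _)]
  refine (h₁.enorm_fourierTX_mul_le (h₂.mul h₃.derivX) p₀).trans (lintegral_mono fun p₁ => ?_)
  rw [lintegral_const_mul _ (by fun_prop)]
  refine mul_le_mul_right ((h₂.enorm_fourierTX_mul_le h₃.derivX (p₀ - p₁)).trans_eq ?_) _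
  refine lintegral_congr fun p₂ => congrArg _ ?_
  refine (absFourier_derivX h₃ _).trans ?_
  rw [hneg, Prod.fst_neg, Int.cast_neg, abs_neg]

/-! ### The norms and the trilinear estimate -/

/-- The weight `⟨ξ⟩ˢ ⟨τ + ξ²⟩ᵇ` of the space `X_{s,b}`. -/
def freqWeight (s b : ℝ) (p : ℤ × ℝ) : ℝ≥0∞ := bracketPow s p.1 * modPow b p

@[fun_prop]
theorem measurable_freqWeight (s b : ℝ) : Measurable (freqWeight s b) := by
  unfold freqWeight
  fun_prop

theorem freqWeight_mul_freqWeight_neg (s b : ℝ) (p : ℤ × ℝ) :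
    freqWeight s b p * freqWeight (-s) (-b) p = 1 := by
  unfold freqWeight modPow
  rw [mul_mul_mul_comm, bracketPow_mul_bracketPow_neg, bracketPow_mul_bracketPow_neg, one_mul]

theorem ofReal_bracket_mul_norm_sq (s b x y : ℝ) (v : ℂ) :
    ENNReal.ofReal (bracket x ^ (2 * s) * bracket y ^ (2 * b) * ‖v‖ ^ 2) =
      (bracketPow s x * bracketPow b y * ‖v‖ₑ) ^ 2 := by
  have hx := bracket_pos x
  have hy := bracket_pos y
  rw [mul_pow, mul_pow, bracketPow_sq, bracketPow_sq, ENNReal.ofReal_mul (by positivity),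
    ENNReal.ofReal_mul (by positivity), ENNReal.ofReal_pow (norm_nonneg _), ofReal_norm]
  rfl

theorem rpow_one_half_sq (a : ℝ≥0∞) : (a ^ (1 / 2 : ℝ)) ^ 2 = a := by
  rw [← ENNReal.rpow_mul_natCast]
  norm_num

theorem IsSPer.normX_sq {f : ℝ → ℝ → ℂ} (hf : IsSPer f) (s b : ℝ) :
    normX s b f ^ 2 = sqNorm freqMeasure (fun p => freqWeight s b p * absFourier f p) := by
  have hm := hf.measurable_absFourier
  unfold normX sqNorm
  rw [rpow_one_half_sq, lintegral_freqMeasure (by fun_prop)]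
  simp_rw [ofReal_bracket_mul_norm_sq]
  rfl

theorem IsSPer.normXMinus_sq {f : ℝ → ℝ → ℂ} (hf : IsSPer f) (s b : ℝ) :
    normXMinus s b f ^ 2 =
      sqNorm freqMeasure (fun p => freqWeight s b p * absFourier f (-p)) := by
  have hm := hf.measurable_absFourier
  have hweight (ξ : ℤ) (τ : ℝ) : freqWeight s b (-(ξ, τ)) =
      bracketPow s ξ * bracketPow b (τ - (ξ : ℝ) ^ 2) := by
    rw [← bracketPow_neg_arg s, ← bracketPow_neg_arg b]
    simp only [freqWeight, modPow, modulation, Prod.neg_mk]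
    push_cast
    ring_nf
  unfold normXMinus sqNorm
  rw [rpow_one_half_sq, ← lintegral_neg_eq_self, lintegral_freqMeasure (by fun_prop)]
  simp_rw [ofReal_bracket_mul_norm_sq, hweight, neg_neg]
  rfl

theorem IsSPer.sqNorm_freqWeight_mul_absFourier {f : ℝ → ℝ → ℂ} (hf : IsSPer f) (s b : ℝ) :
    sqNorm freqMeasure (fun p => freqWeight s b p * absFourier f p) =
      ∑' ξ : ℤ, bracketPow (2 * s) ξ * ∫⁻ τ : ℝ, bracketPow (2 * b) (τ + (ξ : ℝ) ^ 2) *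
        ‖fourierT (hf.fourierXSchwartz ξ) τ‖ₑ ^ 2 := by
  have hm := hf.measurable_absFourier
  unfold sqNorm
  rw [lintegral_freqMeasure (by fun_prop)]
  simp_rw [freqWeight, mul_pow, modPow_sq, bracketPow_sq, mul_assoc,
    lintegral_const_mul' _ _ (bracketPow_ne_top _ _)]
  rfl

theorem IsSPer.sqNorm_modPow_mul_le_of_support {f : ℝ → ℝ → ℂ} (hf : IsSPer f) {T δ : ℝ}
    (hT : 0 < T) (hsupp : ∀ t x, T < |t| → f t x = 0) (s : ℝ) (hδ : 0 ≤ δ) (hδ' : δ ≤ 1 / 2) :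
    sqNorm freqMeasure (fun p => modPow (-δ) p * (freqWeight s (1 / 2) p * absFourier f p)) ≤
      ENNReal.ofReal (4 * T ^ (2 * δ)) *
        sqNorm freqMeasure (fun p => freqWeight s (1 / 2) p * absFourier f p) := by
  have hcombine : (fun p => modPow (-δ) p * (freqWeight s (1 / 2) p * absFourier f p)) =
      fun p => freqWeight s (1 / 2 - δ) p * absFourier f p := by
    ext p
    simp only [freqWeight, modPow, sub_eq_add_neg (1 / 2) δ, bracketPow_add]
    ring
  have hzero (ξ : ℤ) (t : ℝ) (ht : T < |t|) : hf.fourierXSchwartz ξ t = 0 := by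
    change fourierX (f t) ξ = 0
    simp [fourierX, hsupp t _ ht]
  rw [hcombine, hf.sqNorm_freqWeight_mul_absFourier, hf.sqNorm_freqWeight_mul_absFourier,
    ← ENNReal.tsum_mul_left]
  refine ENNReal.tsum_le_tsum fun ξ => ?_
  have hgain := lintegral_bracketPow_mul_fourierT_le_of_support (p := 1 - 2 * δ) hT (by linarith)
    (by linarith) (hzero ξ) ((ξ : ℝ) ^ 2)
  rw [mul_left_comm]
  refine mul_le_mul_right ?_ _
  rw [sub_sub_cancel] at hgain
  have hexp : 2 * (1 / 2 - δ) = 1 - 2 * δ := by ring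
  rwa [hexp, mul_one_div_cancel two_ne_zero]

theorem IsSPer.sqNorm_freqWeight_mul_absFourier_lt_top {f : ℝ → ℝ → ℂ} (hf : IsSPer f) {s b : ℝ}
    (hs : s ≤ 1) (hb : b ≤ 0) :
    sqNorm freqMeasure (fun p => freqWeight s b p * absFourier f p) < ⊤ := by
  obtain ⟨C, hC⟩ := hf.exists_enorm_fourierTX_le
  have hpoint (p : ℤ × ℝ) : freqWeight s b p * absFourier f p ≤
      C * (bracketPow (-1) p.1 * bracketPow (-1) p.2) := by
    have hmod : modPow b p ≤ 1 := (bracketPow_mono hb _).trans_eq (bracketPow_zero _)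
    have hspace : bracketPow s p.1 * bracketPow (-2) p.1 ≤ bracketPow (-1) p.1 := by
      rw [← bracketPow_add]
      exact bracketPow_mono (by linarith) _
    have htime : bracketPow (-2) p.2 ≤ bracketPow (-1) p.2 := bracketPow_mono (by norm_num) _
    calc _ ≤ bracketPow s p.1 * 1 * (C * (bracketPow (-2) p.1 * bracketPow (-2) p.2)) := by
          unfold freqWeight
          gcongr
          exact hC p.2 p.1
      _ = C * (bracketPow s p.1 * bracketPow (-2) p.1 * bracketPow (-2) p.2) := by ring
      _ ≤ _ := by gcongr
  unfold sqNorm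
  refine (lintegral_mono fun p => pow_le_pow_left' (hpoint p) 2).trans_lt ?_
  simp_rw [mul_pow, bracketPow_sq]
  rw [lintegral_const_mul' _ _ (by finiteness), mul_neg_one]
  exact ENNReal.mul_lt_top (by finiteness) (lintegral_bracketPow_freqMeasure_lt_top one_lt_two)

theorem fullKernel_eq (z : (ℤ × ℝ) × (ℤ × ℝ) × (ℤ × ℝ)) :
    fullKernel z = freqWeight (1 / 2) (-(1 / 2)) z.1 * ENNReal.ofReal |((freqThree z).1 : ℝ)| *
      (freqWeight (-(1 / 2)) (-(1 / 2)) z.2.1 * freqWeight (-(1 / 2)) (-(1 / 2)) z.2.2 *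
        freqWeight (-(1 / 2)) (-(1 / 2)) (freqThree z)) := by
  unfold fullKernel multiplier freqWeight
  ring

theorem mul_fullKernel_eq (a₁ a₂ a₃ : ℤ × ℝ → ℝ≥0∞) (z : (ℤ × ℝ) × (ℤ × ℝ) × (ℤ × ℝ)) :
    freqWeight (1 / 2) (1 / 2) z.2.1 * a₁ z.2.1 * (freqWeight (1 / 2) (1 / 2) z.2.2 * a₂ z.2.2 *
        (freqWeight (1 / 2) (1 / 2) (freqThree z) * a₃ (freqThree z))) * fullKernel z =
      freqWeight (1 / 2) (-(1 / 2)) z.1 * (a₁ z.2.1 * (a₂ z.2.2 *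
        (ENNReal.ofReal |((freqThree z).1 : ℝ)| * a₃ (freqThree z)))) := by
  have hinv := freqWeight_mul_freqWeight_neg (1 / 2) (1 / 2)
  rw [fullKernel_eq]
  calc _ = freqWeight (1 / 2) (-(1 / 2)) z.1 * (a₁ z.2.1 * (a₂ z.2.2 *
          (ENNReal.ofReal |((freqThree z).1 : ℝ)| * a₃ (freqThree z)))) *
        ((freqWeight (1 / 2) (1 / 2) z.2.1 * freqWeight (-(1 / 2)) (-(1 / 2)) z.2.1) *
        (freqWeight (1 / 2) (1 / 2) z.2.2 * freqWeight (-(1 / 2)) (-(1 / 2)) z.2.2) *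
        (freqWeight (1 / 2) (1 / 2) (freqThree z) *
          freqWeight (-(1 / 2)) (-(1 / 2)) (freqThree z))) := by ring
    _ = _ := by simp only [hinv, mul_one]

theorem lintegral_mul_absFourier_le_quadForm {u₁ u₂ u₃ : ℝ → ℝ → ℂ} (h₁ : IsSPer u₁)
    (h₂ : IsSPer u₂) (h₃ : IsSPer u₃) {f₀ : ℤ × ℝ → ℝ≥0∞} (h₀ : Measurable f₀) :
    ∫⁻ p, f₀ p * (freqWeight (1 / 2) (-(1 / 2)) p *
        absFourier (fun t x => u₁ t x * u₂ t x * derivX u₃ t x) p) ∂freqMeasure ≤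
      quadForm freqMeasure f₀ (fun p => freqWeight (1 / 2) (1 / 2) p * absFourier u₁ p)
        (fun p => freqWeight (1 / 2) (1 / 2) p * absFourier u₂ p)
        (fun p => freqWeight (1 / 2) (1 / 2) p * absFourier u₃ (-p)) fullKernel := by
  have hm₁ := h₁.measurable_absFourier
  have hm₂ := h₂.measurable_absFourier
  have hm₃ := h₃.measurable_absFourier
  unfold quadForm
  simp_rw [mul_assoc (f₀ _), mul_fullKernel_eq _ _ (fun p => absFourier u₃ (-p))]
  rw [lintegral_prod _ (by fun_prop)]
  refine lintegral_mono fun p => ?_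
  dsimp only
  rw [lintegral_const_mul _ (by fun_prop), lintegral_const_mul _ (by fun_prop)]
  gcongr
  exact absFourier_mul_mul_derivX_le h₁ h₂ h₃ p

theorem le_of_sq_le_mul {a M : ℝ≥0∞} (ha : a ≠ ⊤) (h : a ^ 2 ≤ M * a) : a ≤ M := by
  rcases eq_or_ne a 0 with rfl | h0
  · exact zero_le
  · rw [sq] at h
    exact (ENNReal.mul_le_mul_iff_left h0 ha).1 h

theorem exists_sqNorm_trilinear_le :
    ∃ C : ℝ≥0, ∀ T : ℝ, 0 < T → ∀ u₁ u₂ u₃ : ℝ → ℝ → ℂ, IsSPer u₁ → IsSPer u₂ → IsSPer u₃ →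
      (∀ t x, T < |t| → u₁ t x = 0) → (∀ t x, T < |t| → u₂ t x = 0) →
      sqNorm freqMeasure (fun p => freqWeight (1 / 2) (-(1 / 2)) p *
        absFourier (fun t x => u₁ t x * u₂ t x * derivX u₃ t x) p) ≤
      C * ENNReal.ofReal (4 * T ^ (1 / 50 : ℝ)) *
        (sqNorm freqMeasure (fun p => freqWeight (1 / 2) (1 / 2) p * absFourier u₁ p) *
        sqNorm freqMeasure (fun p => freqWeight (1 / 2) (1 / 2) p * absFourier u₂ p) *
        sqNorm freqMeasure (fun p => freqWeight (1 / 2) (1 / 2) p * absFourier u₃ (-p))) := by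
  obtain ⟨C, hC⟩ := exists_quadForm_fullKernel_sq_le
  refine ⟨C, fun T hT u₁ u₂ u₃ h₁ h₂ h₃ hs₁ hs₂ => ?_⟩
  have hm₁ := h₁.measurable_absFourier
  have hm₂ := h₂.measurable_absFourier
  have hm₃ := h₃.measurable_absFourier
  have hprod := (h₁.mul h₂).mul h₃.derivX
  have hm := hprod.measurable_absFourier
  set f₀ := fun p => freqWeight (1 / 2) (-(1 / 2)) p *
    absFourier (fun t x => u₁ t x * u₂ t x * derivX u₃ t x) p
  have hfin : sqNorm freqMeasure f₀ ≠ ⊤ :=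
    (hprod.sqNorm_freqWeight_mul_absFourier_lt_top (by norm_num) (by norm_num)).ne
  have hgain {u : ℝ → ℝ → ℂ} (h : IsSPer u) (hs : ∀ t x, T < |t| → u t x = 0) :
      sqNorm freqMeasure (fun p => modPow (-(1 / 100)) p *
        (freqWeight (1 / 2) (1 / 2) p * absFourier u p)) ≤ ENNReal.ofReal (4 * T ^ (1 / 50 : ℝ)) *
        sqNorm freqMeasure (fun p => freqWeight (1 / 2) (1 / 2) p * absFourier u p) := by
    convert h.sqNorm_modPow_mul_le_of_support hT hs (δ := 1 / 100) (1 / 2) (by norm_num)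
      (by norm_num) using 5
    norm_num
  refine le_of_sq_le_mul hfin ?_
  calc sqNorm freqMeasure f₀ ^ 2 = (∫⁻ p, f₀ p * f₀ p ∂freqMeasure) ^ 2 := by
        simp_rw [sqNorm, sq]
    _ ≤ _ := pow_le_pow_left' (lintegral_mul_absFourier_le_quadForm h₁ h₂ h₃ (by fun_prop)) 2
    _ ≤ _ := hC (ENNReal.ofReal (4 * T ^ (1 / 50 : ℝ))) f₀ _ _ _ (by fun_prop) (by fun_prop)
        (by fun_prop) (by fun_prop) (hgain h₁ hs₁) (hgain h₂ hs₂)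
    _ = _ := by ring

theorem eq_zero_of_tsupport_subset {f : ℝ → ℝ → ℂ} {T : ℝ}
    (hf : tsupport (fun p : ℝ × ℝ => f p.1 p.2) ⊆ {p | |p.1| ≤ T}) (t x : ℝ) (ht : T < |t|) :
    f t x = 0 :=
  image_eq_zero_of_notMem_tsupport (f := fun p : ℝ × ℝ => f p.1 p.2)
    fun h : (t, x) ∈ _ => ht.not_ge (hf h)

theorem coe_mul_ofReal_le_ofReal_sq (C : ℝ≥0) {T : ℝ} (hT : 0 < T) :
    C * ENNReal.ofReal (4 * T ^ (1 / 50 : ℝ)) ≤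
      ENNReal.ofReal (2 * (C + 1) * T ^ (1 / 100 : ℝ)) ^ 2 := by
  have hpow : T ^ (1 / 50 : ℝ) = (T ^ (1 / 100 : ℝ)) ^ 2 := by
    rw [← Real.rpow_mul_natCast hT.le]
    norm_num
  rw [← ENNReal.ofReal_coe_nnreal, ← ENNReal.ofReal_mul C.coe_nonneg,
    ← ENNReal.ofReal_pow (by positivity), hpow]
  refine ENNReal.ofReal_le_ofReal ?_
  have hC : (C : ℝ) ≤ (C + 1) ^ 2 := by nlinarith [C.coe_nonneg]
  calc (C : ℝ) * (4 * (T ^ (1 / 100 : ℝ)) ^ 2) ≤ (C + 1) ^ 2 * (4 * (T ^ (1 / 100 : ℝ)) ^ 2) := by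
        gcongr
    _ = _ := by ring

end PeriodicBourgain

end

theorem theorem2_general :
    ∃ c ε : ℝ, 0 < c ∧ 0 < ε ∧
      ∀ T : ℝ, 0 < T →
        ∀ u₁ u₂ u₃ : ℝ → ℝ → ℂ,
          PeriodicBourgain.IsSPer u₁ → PeriodicBourgain.IsSPer u₂ → PeriodicBourgain.IsSPer u₃ →
          tsupport (fun p : ℝ × ℝ => u₁ p.1 p.2) ⊆ {p | |p.1| ≤ T} →
          tsupport (fun p : ℝ × ℝ => u₂ p.1 p.2) ⊆ {p | |p.1| ≤ T} →
          PeriodicBourgain.normX (1 / 2) (-(1 / 2))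
              (fun t x => u₁ t x * u₂ t x * deriv (fun y => u₃ t y) x) ≤
            ENNReal.ofReal (c * T ^ ε) *
              PeriodicBourgain.normX (1 / 2) (1 / 2) u₁ *
              PeriodicBourgain.normX (1 / 2) (1 / 2) u₂ *
              PeriodicBourgain.normXMinus (1 / 2) (1 / 2) u₃ := by
  obtain ⟨C, hC⟩ := PeriodicBourgain.exists_sqNorm_trilinear_le
  refine ⟨2 * (C + 1), 1 / 100, by positivity, by norm_num, ?_⟩
  intro T hT u₁ u₂ u₃ h₁ h₂ h₃ hs₁ hs₂
  have hprod : PeriodicBourgain.IsSPer fun t x => u₁ t x * u₂ t x * deriv (fun y => u₃ t y) x :=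
    (h₁.mul h₂).mul h₃.derivX
  rw [← ENNReal.pow_le_pow_left_iff two_ne_zero]
  simp only [mul_pow, h₁.normX_sq, h₂.normX_sq, h₃.normXMinus_sq, hprod.normX_sq]
  refine (hC T hT u₁ u₂ u₃ h₁ h₂ h₃ (PeriodicBourgain.eq_zero_of_tsupport_subset hs₁)
    (PeriodicBourgain.eq_zero_of_tsupport_subset hs₂)).trans ?_
  simp only [← mul_assoc]
  gcongr
  exact PeriodicBourgain.coe_mul_ofReal_le_ofReal_sq C hT

theorem theorem2 :
    ∃ c ε : ℝ, 0 < c ∧ 0 < ε ∧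
      ∀ T : ℝ, 0 < T → T ≤ 1 →
        ∀ u₁ u₂ u₃ : ℝ → ℝ → ℂ,
          PeriodicBourgain.IsSPer u₁ → PeriodicBourgain.IsSPer u₂ → PeriodicBourgain.IsSPer u₃ →
          tsupport (fun p : ℝ × ℝ => u₁ p.1 p.2) ⊆ {p | |p.1| ≤ T} →
          tsupport (fun p : ℝ × ℝ => u₂ p.1 p.2) ⊆ {p | |p.1| ≤ T} →
          tsupport (fun p : ℝ × ℝ => u₃ p.1 p.2) ⊆ {p | |p.1| ≤ T} →
          PeriodicBourgain.normX (1 / 2) (-(1 / 2))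
              (fun t x => u₁ t x * u₂ t x * deriv (fun y => u₃ t y) x) ≤
            ENNReal.ofReal (c * T ^ ε) *
              PeriodicBourgain.normX (1 / 2) (1 / 2) u₁ *
              PeriodicBourgain.normX (1 / 2) (1 / 2) u₂ *
              PeriodicBourgain.normXMinus (1 / 2) (1 / 2) u₃ := by
  obtain ⟨c, ε, hc, hε, h⟩ := theorem2_general
  exact ⟨c, ε, hc, hε, fun T hT _ u₁ u₂ u₃ h₁ h₂ h₃ hs₁ hs₂ _ => h T hT u₁ u₂ u₃ h₁ h₂ h₃ hs₁ hs₂⟩
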